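/- Consider the equations $u_t+u^nu_x=g(t)u_{xx}$ for $u>0$, where $n\neq0$ is a real constant and $g$ is a smooth nowhere vanishing function on an open interval; the pair $(g,n)$ is the arbitrary element of the class. An admissible transformation (an element of the equivalence groupoid) of a subclass is a triple consisting of two arbitrary elements $(g,n)$, $(\tilde g,\tilde n)$ of the subclass and a point transformation $\varphi\colon(t,x,u)\mapsto(\tilde t,\tilde x,\tilde u)$, that is, a smooth map on a connected open set $\Omega\subset\{t\in\operatorname{dom}g,\ u>0\}$ with nonvanishing Jacobian and values in $\{\tilde t\in\operatorname{dom}\tilde g,\ \tilde u>0\}$, whose second prolongation maps the manifold of the first equation in the second-order jet space to that of the second. The generalized equivalence (pseudo)group of the subclass consists of the smooth maps $\Phi$ with nonvanishing Jacobian, defined on open subsets of the part $u>0$, $g\neq0$ (with $n$ in the set of exponents of the subclass) of the space of $(t,x,u,g,n)$ and with values in that part, such that, for every arbitrary element of the subclass, $\Phi$ locally maps it to an arbitrary element of the subclass and, after substitution of the arbitrary element, induces an admissible transformation between the corresponding equations. A subclass is normalized in the generalized sense if each of its admissible transformations is induced by an element of its generalized equivalence group. The following hold. 1. The subclass singled out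 by $n\neq1$ (with $n\ne0$) is normalized in the generalized sense. More precisely, every admissible transformation of this subclass is induced by one of the transformations $$\tilde t=\alpha t+\beta,\quad \tilde x=\delta_1x+\delta_0,\quad \tilde u=\Bigl(\frac{\delta_1}{\alpha}\Bigr)^{1/n}u,\quad \tilde g(\tilde t)=\frac{\delta_1^2}{\alpha}\,g(t),\quad \tilde n=n,\qquad(*)$$ where $\alpha,\beta,\delta_0,\delta_1$ are real constants with $\alpha\delta_1>0$. 2. Both for the subclass $n\ne1$ and for the entire class $n\neq0$, the generalized equivalence group consists of the transformations $(*)$, where $\alpha,\beta,\delta_0,\delta_1$ with $\alpha\delta_1>0$ are constants in the sense that they do not depend on $t,x,u,g$, but may depend smoothly on the constant arbitrary element $n$. That is: for any real numbers $\alpha,\beta,\delta_0,\delta_1$ with $\alpha\delta_1>0$ the transformation $(*)$, on the whole space of $(t,x,u,g,n)$ with $u>0$, $g\ne0$ and $n$ in the respective set of exponents, belongs to the group; and, if $D$ is an open subset of that space whose sections $n=\mathrm{const}$ are connected, then a map $\Phi$ on $D$ belongs to the group if and only if it is of the form $(*)$ with smooth functions $\alpha,\beta,\delta_0,\delta_1$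 of $n$, defined on the projection of $D$ to the $n$-axis, such that $\alpha\delta_1>0$. 3. The generalized equivalence groups of the subclass $n\neq1$ and of the entire class coincide: a map defined on a subset of the region $u>0$, $g\neq0$, $n\ne0,1$ belongs to one of them if and only if it belongs to the other. -/

import Mathlib

open Set Filter Topology
open scoped ContDiff

namespace GenBurgers

/-- Arbitrary elements of the class `u_t + u^n u_x = g(t) u_xx`: an exponent `n` and a coefficient
function `g`, of which only the restriction to the time interval `dom` is meaningful. -/
structure ArbElem where
  dom : Set ℝ
  g : ℝ → ℝ
  n : ℝ

/-- The arbitrary elements of the class of equations `u_t + u^n u_x = g(t) u_xx` with `n ∈ N`: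
`g` is a smooth nowhere vanishing function on an open interval. -/
def ArbElem.InClass (N : Set ℝ) (θ : ArbElem) : Prop :=
  IsOpen θ.dom ∧ IsConnected θ.dom ∧ ContDiffOn ℝ ∞ θ.g θ.dom ∧ (∀ t ∈ θ.dom, θ.g t ≠ 0) ∧ θ.n ∈ N

/-- The exponents of the entire class, `n ≠ 0`. -/
def allExponents : Set ℝ := {n | n ≠ 0}

/-- The exponents of the subclass singled out by `n ≠ 1`. -/
def exponentsNeOne : Set ℝ := {n | n ≠ 0 ∧ n ≠ 1}

/-- The space of the variables `(t, x, u)` of the equation: `t` in the domain of `g`, and `u > 0`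
(so that `u ^ n` makes sense for every real `n`). -/
def ArbElem.phase (θ : ArbElem) : Set (ℝ × ℝ × ℝ) := {q | q.1 ∈ θ.dom ∧ 0 < q.2.2}

/-- The equation `u_t + u^n u_x = g(t) u_xx` holds for the function `u` at the point `q = (t, x)`,
that is, the 2-jet of `u` at `q` lies on the manifold that the equation defines in the
second-order jet space. -/
def ArbElem.HoldsAt (θ : ArbElem) (u : ℝ × ℝ → ℝ) (q : ℝ × ℝ) : Prop :=
  deriv (fun s => u (s, q.2)) q.1 + u q ^ θ.n * deriv (fun y => u (q.1, y)) q.2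
    = θ.g q.1 * iteratedDeriv 2 (fun y => u (q.1, y)) q.2

/-- `(T, X)` along the graph of `u`: the new independent variables as functions of the old ones. -/
def newIndep (φ : ℝ × ℝ × ℝ → ℝ × ℝ × ℝ) (u : ℝ × ℝ → ℝ) (r : ℝ × ℝ) : ℝ × ℝ :=
  ((φ (r.1, r.2, u r)).1, (φ (r.1, r.2, u r)).2.1)

/-- `U` along the graph of `u`: the new dependent variable as a function of the old `(t, x)`. -/
def newDep (φ : ℝ × ℝ × ℝ → ℝ × ℝ × ℝ) (u : ℝ × ℝ → ℝ) (r : ℝ × ℝ) : ℝ :=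
  (φ (r.1, r.2, u r)).2.2

/-- A point transformation on `Ω`: a smooth map `(t, x, u) ↦ (T, X, U)` with nonvanishing Jacobian
(also used for transformations of the space that is extended by the arbitrary elements). -/
def IsPointTransf {V : Type*} [NormedAddCommGroup V] [NormedSpace ℝ V]
    (Ω : Set V) (φ : V → V) : Prop :=
  IsOpen Ω ∧ ContDiffOn ℝ ∞ φ Ω ∧ ∀ q ∈ Ω, (fderiv ℝ φ q).det ≠ 0

/-- The second prolongation of `φ` maps the manifold of the equation `θ` in the second-order jet
space to the manifold of the equation `θ'`. The 2-jets are represented by (germs of) smooth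
functions: the 2-jet of `u` at `q` is mapped to the 2-jet of `v` at `newIndep φ u q` if the
image under `φ` of the graph of `u` near `q` is the graph of `v`. -/
def MapsEquation (θ θ' : ArbElem) (Ω : Set (ℝ × ℝ × ℝ)) (φ : ℝ × ℝ × ℝ → ℝ × ℝ × ℝ) : Prop :=
  ∀ (u v : ℝ × ℝ → ℝ) (q : ℝ × ℝ), (q.1, q.2, u q) ∈ Ω → ContDiffAt ℝ ∞ u q →
    (fderiv ℝ (newIndep φ u) q).det ≠ 0 → ContDiffAt ℝ ∞ v (newIndep φ u q) →
    (∀ᶠ r in 𝓝 q, v (newIndep φ u r) = newDep φ u r) →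
    (θ.HoldsAt u q ↔ θ'.HoldsAt v (newIndep φ u q))

/-- `(θ, θ', φ)` is an admissible transformation (an element of the equivalence groupoid) of the
class with exponents in `N`: both equations belong to the class, and the point transformation `φ`,
defined on the domain `Ω` of the space of `(t, x, u)`, maps the first equation to the second. -/
def Admissible (N : Set ℝ) (θ θ' : ArbElem) (Ω : Set (ℝ × ℝ × ℝ))
    (φ : ℝ × ℝ × ℝ → ℝ × ℝ × ℝ) : Prop :=
  θ.InClass N ∧ θ'.InClass N ∧ IsConnected Ω ∧ Ω ⊆ θ.phase ∧ MapsTo φ Ω θ'.phase ∧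
    IsPointTransf Ω φ ∧ MapsEquation θ θ' Ω φ

/-- The space of `(t, x, u, g, n)`. -/
abbrev ExtSpace : Type := ℝ × ℝ × ℝ × ℝ × ℝ

/-- The value of the arbitrary element `n` at a point of the extended space. -/
def nCoord (p : ExtSpace) : ℝ := p.2.2.2.2

/-- The part `u > 0`, `g ≠ 0`, `n ∈ N` of the space of `(t, x, u, g, n)`. -/
def ext (N : Set ℝ) : Set ExtSpace := {p | 0 < p.2.2.1 ∧ p.2.2.2.1 ≠ 0 ∧ nCoord p ∈ N}

/-- The point `(t, x, u, g(t), n)` over `(t, x, u)`. -/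
def ArbElem.lift (θ : ArbElem) (q : ℝ × ℝ × ℝ) : ExtSpace := (q.1, q.2.1, q.2.2, θ.g q.1, θ.n)

/-- On `Ω`, the transformation `Φ` (with domain `D`) of the extended space induces the triple
`(θ, θ', φ)`: substituting `θ` for the arbitrary elements in the `(t, x, u)`-components of `Φ`
gives `φ`, and `Φ` maps the arbitrary elements `θ` to `θ'`. -/
def Induces (D : Set ExtSpace) (Φ : ExtSpace → ExtSpace) (θ θ' : ArbElem)
    (Ω : Set (ℝ × ℝ × ℝ)) (φ : ℝ × ℝ × ℝ → ℝ × ℝ × ℝ) : Prop :=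
  ∀ q ∈ Ω, θ.lift q ∈ D ∧ Φ (θ.lift q) = θ'.lift (φ q)

/-- `Φ`, defined on `D`, belongs to the generalized equivalence (pseudo)group of the class with
exponents in `N`: it is a point transformation of the space of `(t, x, u, g, n)`, all components of
which may depend on all of the variables, and for all arbitrary elements `θ` of the class it
(locally) induces an admissible transformation of the equation `θ`. -/
def InGenEquivGroup (N : Set ℝ) (D : Set ExtSpace) (Φ : ExtSpace → ExtSpace) : Prop :=
  D ⊆ ext N ∧ MapsTo Φ D (ext N) ∧ IsPointTransf D Φ ∧
    ∀ θ : ArbElem, θ.InClass N → ∀ q ∈ θ.phase, θ.lift q ∈ D →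
      ∃ (Ω : Set (ℝ × ℝ × ℝ)) (θ' : ArbElem) (φ : ℝ × ℝ × ℝ → ℝ × ℝ × ℝ),
        q ∈ Ω ∧ Admissible N θ θ' Ω φ ∧ Induces D Φ θ θ' Ω φ

/-- The class with exponents in `N` is normalized in the generalized sense: each of its admissible
transformations is induced by an element of its generalized equivalence group. -/
def NormalizedGen (N : Set ℝ) : Prop :=
  ∀ (θ θ' : ArbElem) (Ω : Set (ℝ × ℝ × ℝ)) (φ : ℝ × ℝ × ℝ → ℝ × ℝ × ℝ),
    Admissible N θ θ' Ω φ →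
      ∃ (D : Set ExtSpace) (Φ : ExtSpace → ExtSpace),
        InGenEquivGroup N D Φ ∧ Induces D Φ θ θ' Ω φ

/-- The transformation `t' = α t + β`, `x' = δ₁ x + δ₀`, `u' = (δ₁ / α)^(1/n) u`,
`g' = (δ₁² / α) g`, `n' = n`. -/
noncomputable def affTransf (α β δ₁ δ₀ : ℝ) (p : ExtSpace) : ExtSpace :=
  (α * p.1 + β, δ₁ * p.2.1 + δ₀, (δ₁ / α) ^ (1 / nCoord p) * p.2.2.1,
    δ₁ ^ 2 / α * p.2.2.2.1, nCoord p)

end GenBurgers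

namespace GenBurgers

/-! The core is Lie's method for finite point transformations `(t, x, u) ↦ (T, X, U)`. By
`exists_prolonged_jet`, every 2-jet with `u_tx = 0` whose image is transversal is realized by a
quadratic polynomial, and the chain rule expresses the image jet in terms of it. Only the
implication "source equation holds, hence target equation holds" is then exploited, by varying the
free jet coordinates.

Varying `u_tt`, which the equation does not restrict, gives `T_x = T_u = 0`. Varying `u_xx` gives `g
(X_x + u_x X_u)² = g̃(T) T_t`, whence `X_u = 0`. What remains is a polynomial of degree two in
`u_x`, whose coefficients are the equations of `determining`; in particular `U_uu = 0`.
Differentiating the coefficient of `u_x` repeatedly with respect to `u` yields `(ñ - 1) u U_u = (n -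
1) U` and then `ñ = n`. If `n ≠ 1`, this forces `U = u U_u`, and everything else collapses: `U_u`,
`X_x` and `T_t` are constants with `U_u^n T_t = X_x`. This is `Admissible.exists_affTransf`, and it
settles the equivalence groupoid.

Conversely, an affine transformation multiplies every term of the equation by the same constant
(`mapsEquation_affine`), so it lies in the group even if its parameters depend on `n`, since `n` is
constant for each single equation (`inGenEquivGroup_affTransf`). Normalization follows.

For the form of an arbitrary group element `Φ`, the groupoid result is applied to the coefficients
`g exp(s (t - t₀))`. The values `s = 0` and `s = 1` separate the derivatives with respect to `t` and
`g`, which gives differential equations for `Φ` wherever `n ≠ 1`. They extend to `n = 1` by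
continuity, because the domain of `Φ` is open (`InGenEquivGroup.determinedAt`). So the entire class
has no further elements in spite of the exceptional exponent. Integration over connected sections `n
= const` produces parameters that are smooth functions of `n`. -/

/-- The derivative of `f` at `p` in the direction `v`. -/
noncomputable def pd {E : Type*} [NormedAddCommGroup E] [NormedSpace ℝ E]
    (v : E) (f : E → ℝ) (p : E) : ℝ := fderiv ℝ f p v

/-! ### Directional derivatives and the second-order chain rule -/

section Calculus

variable {E F G : Type*} [NormedAddCommGroup E] [NormedSpace ℝ E]
  [NormedAddCommGroup F] [NormedSpace ℝ F] [NormedAddCommGroup G] [NormedSpace ℝ G]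

theorem contDiffOn_pd {s : Set E} {f : E → ℝ} (hs : IsOpen s) (hf : ContDiffOn ℝ ∞ f s) (v : E) :
    ContDiffOn ℝ ∞ (pd v f) s :=
  (hf.fderiv_of_isOpen hs (m := ∞) (by simp)).clm_apply contDiffOn_const

theorem fderiv_fderiv_eq_pd_pd {s : Set E} {f : E → ℝ} (hs : IsOpen s) (hf : ContDiffOn ℝ ∞ f s)
    {p : E} (hp : p ∈ s) (v w : E) : fderiv ℝ (fderiv ℝ f) p v w = pd v (pd w f) p := by
  have h1 : DifferentiableAt ℝ (fderiv ℝ f) p :=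
    ((hf.fderiv_of_isOpen hs (m := ∞) (by simp)).contDiffAt (hs.mem_nhds hp)).differentiableAt
      (by simp)
  have h2 := h1.hasFDerivAt.clm_apply (hasFDerivAt_const w p)
  change _ = fderiv ℝ (fun p => fderiv ℝ f p w) p v
  rw [h2.fderiv]
  simp

theorem pd_comm {s : Set E} {f : E → ℝ} (hs : IsOpen s) (hf : ContDiffOn ℝ ∞ f s)
    {p : E} (hp : p ∈ s) (v w : E) : pd v (pd w f) p = pd w (pd v f) p := by
  rw [← fderiv_fderiv_eq_pd_pd hs hf hp, ← fderiv_fderiv_eq_pd_pd hs hf hp]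
  have h := (hf.contDiffAt (hs.mem_nhds hp)).isSymmSndFDerivAt (n := ∞)
    (by simpa using WithTop.coe_le_coe.2 (le_top : (2 : ℕ∞) ≤ ⊤))
  exact h v w

theorem hasDerivAt_pd {s : Set E} {f : E → ℝ} (hs : IsOpen s) (hf : ContDiffOn ℝ ∞ f s)
    {p : E} (hp : p ∈ s) (v : E) : HasDerivAt (fun r : ℝ => f (p + r • v)) (pd v f p) 0 :=
  (((hf.contDiffAt (hs.mem_nhds hp)).differentiableAt
    (by simp)).hasFDerivAt.hasLineDerivAt v)

theorem eventually_mem_line {s : Set E} (hs : IsOpen s) {p : E} (hp : p ∈ s) (v : E) :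
    ∀ᶠ r : ℝ in 𝓝 0, p + r • v ∈ s := by
  have h : ContinuousAt (fun r : ℝ => p + r • v) 0 := by fun_prop
  exact h.eventually_mem (by simpa using hs.mem_nhds hp)

/-- The device for differentiating an identity that holds on an open set. Both sides need only be
differentiable along one line, so a factor depending on `t` alone is harmless in the directions of
`x` and `u`. -/
theorem lineDeriv_unique {s : Set E} {f₁ f₂ : E → ℝ} (hs : IsOpen s) {p : E} (hp : p ∈ s)
    (h : ∀ p ∈ s, f₁ p = f₂ p) {v : E} {a b : ℝ}
    (h₁ : HasDerivAt (fun r : ℝ => f₁ (p + r • v)) a 0)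
    (h₂ : HasDerivAt (fun r : ℝ => f₂ (p + r • v)) b 0) : a = b := by
  refine h₁.unique (h₂.congr_of_eventuallyEq ?_)
  filter_upwards [eventually_mem_line hs hp v] with r hr using h _ hr

theorem pd_eq_zero {s : Set E} {f : E → ℝ} {c : ℝ} (hs : IsOpen s) {p : E} (hp : p ∈ s)
    (h : ∀ p ∈ s, f p = c) (v : E) : pd v f p = 0 := by
  have : f =ᶠ[𝓝 p] fun _ => c := by
    filter_upwards [hs.mem_nhds hp] with r hr using h r hr
  rw [pd, this.fderiv_eq]
  simp

/-- The second-order chain rule. -/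
theorem fderiv_fderiv_comp {f : F → G} {g : E → F} {q : E} (hf : ContDiffAt ℝ ∞ f (g q))
    (hg : ContDiffAt ℝ ∞ g q) (d : E) :
    fderiv ℝ (fderiv ℝ (f ∘ g)) q d d =
      fderiv ℝ (fderiv ℝ f) (g q) (fderiv ℝ g q d) (fderiv ℝ g q d) +
        fderiv ℝ f (g q) (fderiv ℝ (fderiv ℝ g) q d d) := by
  have h1 : fderiv ℝ (f ∘ g) =ᶠ[𝓝 q] fun r => (fderiv ℝ f (g r)).comp (fderiv ℝ g r) := by
    have hf' := hg.continuousAt.eventually ((hf.of_le (m := 1) (by simp)).eventually (by simp))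
    filter_upwards [hf', (hg.of_le (m := 1) (by simp)).eventually (by simp)] with r h1 h2
    exact fderiv_comp r (h1.differentiableAt (by simp)) (h2.differentiableAt (by simp))
  have hdf : DifferentiableAt ℝ (fderiv ℝ f) (g q) :=
    (hf.fderiv_right (m := ∞) (by simp)).differentiableAt (by simp)
  have hdg : DifferentiableAt ℝ (fderiv ℝ g) q :=
    (hg.fderiv_right (m := ∞) (by simp)).differentiableAt (by simp)
  have hg1 : DifferentiableAt ℝ g q := hg.differentiableAt (by simp)
  have h2 := (hdf.hasFDerivAt.comp q hg1.hasFDerivAt).clm_comp hdg.hasFDerivAt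
  have h3 := h2.congr_of_eventuallyEq h1
  rw [h3.fderiv]
  simp [add_comm]

theorem det_ne_zero_iff_injective [FiniteDimensional ℝ E] (A : E →L[ℝ] E) :
    A.det ≠ 0 ↔ Function.Injective A := by
  have h := LinearMap.isUnit_iff_isUnit_det (A : E →ₗ[ℝ] E)
  rw [isUnit_iff_ne_zero, LinearMap.isUnit_iff_ker_eq_bot, LinearMap.ker_eq_bot] at h
  exact h.symm

theorem deriv_fst_eq {u : ℝ × ℝ → ℝ} {q : ℝ × ℝ} (hu : DifferentiableAt ℝ u q) :
    deriv (fun s => u (s, q.2)) q.1 = fderiv ℝ u q (1, 0) := by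
  have h : HasDerivAt (fun s : ℝ => (s, q.2)) ((1 : ℝ), (0 : ℝ)) q.1 :=
    (hasDerivAt_id _).prodMk (hasDerivAt_const _ _)
  exact (HasFDerivAt.comp_hasDerivAt (f := fun s : ℝ => (s, q.2)) q.1 hu.hasFDerivAt h).deriv

theorem deriv_snd_eq {u : ℝ × ℝ → ℝ} {q : ℝ × ℝ} (hu : DifferentiableAt ℝ u q) :
    deriv (fun y => u (q.1, y)) q.2 = fderiv ℝ u q (0, 1) := by
  have h : HasDerivAt (fun s : ℝ => (q.1, s)) ((0 : ℝ), (1 : ℝ)) q.2 :=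
    (hasDerivAt_const _ _).prodMk (hasDerivAt_id _)
  exact (HasFDerivAt.comp_hasDerivAt (f := fun s : ℝ => (q.1, s)) q.2 hu.hasFDerivAt h).deriv

theorem iteratedDeriv_two_snd_eq {u : ℝ × ℝ → ℝ} {q : ℝ × ℝ} (hu : ContDiffAt ℝ ∞ u q) :
    iteratedDeriv 2 (fun y => u (q.1, y)) q.2 = fderiv ℝ (fderiv ℝ u) q (0, 1) (0, 1) := by
  have h : HasDerivAt (fun s : ℝ => (q.1, s)) ((0 : ℝ), (1 : ℝ)) q.2 :=
    (hasDerivAt_const _ _).prodMk (hasDerivAt_id _)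
  have h1 : deriv (fun y => u (q.1, y)) =ᶠ[𝓝 q.2] fun y => fderiv ℝ u (q.1, y) (0, 1) := by
    have hc : ContinuousAt (fun s : ℝ => (q.1, s)) q.2 := by fun_prop
    filter_upwards [hc.eventually ((hu.of_le (m := 1) (by simp)).eventually (by simp))] with y hy
    exact deriv_snd_eq (q := (q.1, y)) (hy.differentiableAt (by simp))
  have hd : DifferentiableAt ℝ (fderiv ℝ u) q :=
    (hu.fderiv_right (m := ∞) (by simp)).differentiableAt (by simp)
  rw [iteratedDeriv_succ, iteratedDeriv_one, h1.deriv_eq]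
  have h2 := (HasFDerivAt.comp_hasDerivAt (f := fun s : ℝ => (q.1, s)) q.2 hd.hasFDerivAt h)
  have h3 := h2.clm_apply (hasDerivAt_const q.2 ((0 : ℝ), (1 : ℝ)))
  simpa using h3.deriv

end Calculus

/-! ### The action of a point transformation on 2-jets -/

theorem ArbElem.holdsAt_iff {θ : ArbElem} {u : ℝ × ℝ → ℝ} {q : ℝ × ℝ} (hu : ContDiffAt ℝ ∞ u q) :
    θ.HoldsAt u q ↔ fderiv ℝ u q (1, 0) + u q ^ θ.n * fderiv ℝ u q (0, 1) =
      θ.g q.1 * fderiv ℝ (fderiv ℝ u) q (0, 1) (0, 1) := by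
  have hd : DifferentiableAt ℝ u q := hu.differentiableAt (by simp)
  rw [ArbElem.HoldsAt, deriv_fst_eq hd, deriv_snd_eq hd, iteratedDeriv_two_snd_eq hu]

theorem fderiv_fderiv_clm_comp {E F G : Type*} [NormedAddCommGroup E] [NormedSpace ℝ E]
    [NormedAddCommGroup F] [NormedSpace ℝ F] [NormedAddCommGroup G] [NormedSpace ℝ G]
    (A : F →L[ℝ] G) {g : E → F} {q : E} (hg : ContDiffAt ℝ ∞ g q) (d : E) :
    fderiv ℝ (fderiv ℝ (fun r => A (g r))) q d d = A (fderiv ℝ (fderiv ℝ g) q d d) := by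
  have h := fderiv_fderiv_comp (f := A) A.contDiff.contDiffAt hg d
  have h1 : fderiv ℝ A = fun _ => A := funext fun _ => A.fderiv
  rw [h1] at h
  simp only [fderiv_fun_const, Pi.zero_apply, zero_apply, zero_add] at h
  exact h

theorem fderiv_clm_comp {E F G : Type*} [NormedAddCommGroup E] [NormedSpace ℝ E]
    [NormedAddCommGroup F] [NormedSpace ℝ F] [NormedAddCommGroup G] [NormedSpace ℝ G]
    (A : F →L[ℝ] G) {g : E → F} {q : E} (hg : ContDiffAt ℝ ∞ g q) (d : E) :
    fderiv ℝ (fun r => A (g r)) q d = A (fderiv ℝ g q d) := by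
  have h := (A.hasFDerivAt.comp q (hg.differentiableAt (by simp)).hasFDerivAt).fderiv
  exact congrArg (fun B : E →L[ℝ] G => B d) h

theorem apply_prod_eq (A : ℝ × ℝ →L[ℝ] ℝ) (x y : ℝ) : A (x, y) = A (1, 0) * x + A (0, 1) * y := by
  have h : ((x, y) : ℝ × ℝ) = x • (1, 0) + y • (0, 1) := by simp
  rw [h, map_add, map_smul, map_smul]
  simp only [smul_eq_mul]
  ring

/-- The image under `φ` of the graph of a function is locally the graph of a function, if the new
independent variables are independent along the graph. -/
theorem exists_image_germ {φ : ℝ × ℝ × ℝ → ℝ × ℝ × ℝ} {u : ℝ × ℝ → ℝ} {q : ℝ × ℝ}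
    (hφ : ContDiffAt ℝ ∞ φ (q.1, q.2, u q)) (hu : ContDiffAt ℝ ∞ u q)
    (hdet : (fderiv ℝ (newIndep φ u) q).det ≠ 0) :
    ∃ v : ℝ × ℝ → ℝ, ContDiffAt ℝ ∞ v (newIndep φ u q) ∧
      ∀ᶠ r in 𝓝 q, v (newIndep φ u r) = newDep φ u r := by
  have hΓ : ContDiffAt ℝ ∞ (fun r : ℝ × ℝ => (r.1, r.2, u r)) q :=
    contDiffAt_fst.prodMk (contDiffAt_snd.prodMk hu)
  have hφΓ : ContDiffAt ℝ ∞ (fun r : ℝ × ℝ => φ (r.1, r.2, u r)) q :=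
    ContDiffAt.comp (f := fun r : ℝ × ℝ => (r.1, r.2, u r)) q hφ hΓ
  have hi : ContDiffAt ℝ ∞ (newIndep φ u) q := hφΓ.fst.prodMk hφΓ.snd.fst
  have hd : ContDiffAt ℝ ∞ (newDep φ u) q := hφΓ.snd.snd
  let e := ContinuousLinearMap.toContinuousLinearEquivOfDetNeZero _ hdet
  have he : HasFDerivAt (newIndep φ u) (e : ℝ × ℝ →L[ℝ] ℝ × ℝ) q := by
    simpa [e] using (hi.differentiableAt (by simp)).hasFDerivAt
  -- By the inverse function theorem `(T, X)` along the graph is locally invertible, and `U` is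
  -- rewritten in the new independent variables.
  refine ⟨newDep φ u ∘ hi.localInverse he (by simp), ?_, ?_⟩
  · have h1 := hi.to_localInverse he (by simp)
    have h2 : hi.localInverse he (by simp) (newIndep φ u q) = q :=
      hi.localInverse_apply_image he (by simp)
    exact ContDiffAt.comp _ (by rwa [h2]) h1
  · have h3 : HasStrictFDerivAt (newIndep φ u) (e : ℝ × ℝ →L[ℝ] ℝ × ℝ) q :=
      hi.hasStrictFDerivAt' he (by simp)
    filter_upwards [h3.eventually_left_inverse] with r hr
    exact congrArg (newDep φ u) hr

/-- The relations between the coordinates of a 2-jet over a point, with first-order part `(b, a)`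
and second-order part `(e, 0, c)`, and of the coordinates of its image under the second
prolongation of a point transformation. -/
theorem exists_prolonged_jet {θ θ' : ArbElem} {Ω : Set (ℝ × ℝ × ℝ)}
    {φ : ℝ × ℝ × ℝ → ℝ × ℝ × ℝ} (h : MapsEquation θ θ' Ω φ) (hΩ : IsOpen Ω)
    (hφ : ContDiffOn ℝ ∞ φ Ω) {p : ℝ × ℝ × ℝ} (hp : p ∈ Ω) (a b c e : ℝ)
    (hΔ : (fderiv ℝ φ p (1, 0, b)).1 * (fderiv ℝ φ p (0, 1, a)).2.1 -
      (fderiv ℝ φ p (0, 1, a)).1 * (fderiv ℝ φ p (1, 0, b)).2.1 ≠ 0) :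
    ∃ vT vX vXX : ℝ,
      (fderiv ℝ φ p (1, 0, b)).2.2 =
        vT * (fderiv ℝ φ p (1, 0, b)).1 + vX * (fderiv ℝ φ p (1, 0, b)).2.1 ∧
      (fderiv ℝ φ p (0, 1, a)).2.2 =
        vT * (fderiv ℝ φ p (0, 1, a)).1 + vX * (fderiv ℝ φ p (0, 1, a)).2.1 ∧
      (∀ d₁ d₂ : ℝ, ∀ J K : ℝ × ℝ × ℝ, J = (d₁, d₂, b * d₁ + a * d₂) →
        K = fderiv ℝ (fderiv ℝ φ) p J J + fderiv ℝ φ p (0, 0, e * d₁ ^ 2 + c * d₂ ^ 2) →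
        (fderiv ℝ φ p J).1 = 0 →
        K.2.2 = vXX * (fderiv ℝ φ p J).2.1 ^ 2 + vT * K.1 + vX * K.2.1) ∧
      (b + p.2.2 ^ θ.n * a = θ.g p.1 * c ↔
        vT + (φ p).2.2 ^ θ'.n * vX = θ'.g (φ p).1 * vXX) := by
  obtain ⟨t, x, w⟩ := p
  -- The quadratic polynomial with value `w`, `u_t = b`, `u_x = a`, `u_xx = c`, `u_tt = e` and `u_tx
  -- = 0` at the given point.
  set u : ℝ × ℝ → ℝ := fun r =>
    w + b * (r.1 - t) + a * (r.2 - x) + c / 2 * (r.2 - x) ^ 2 + e / 2 * (r.1 - t) ^ 2 with hu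
  have huq : u (t, x) = w := by simp [hu]
  have huc : ContDiff ℝ ∞ u := by
    rw [hu]
    fun_prop
  have hu1 : fderiv ℝ u = fun r => (b + e * (r.1 - t)) • ContinuousLinearMap.fst ℝ ℝ ℝ +
      (a + c * (r.2 - x)) • ContinuousLinearMap.snd ℝ ℝ ℝ := by
    funext r
    have e1 : HasFDerivAt (fun r : ℝ × ℝ => r.1 - t) (ContinuousLinearMap.fst ℝ ℝ ℝ) r :=
      hasFDerivAt_fst.sub_const t
    have e2 : HasFDerivAt (fun r : ℝ × ℝ => r.2 - x) (ContinuousLinearMap.snd ℝ ℝ ℝ) r :=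
      hasFDerivAt_snd.sub_const x
    have e3 := ((((e1.const_mul b).const_add w).add (e2.const_mul a)).add
      ((e2.pow 2).const_mul (c / 2))).add ((e1.pow 2).const_mul (e / 2))
    refine (HasFDerivAt.fderiv (e3.congr_of_eventuallyEq (.of_forall fun r => ?_))).trans ?_
    · simp [hu]
    · ext <;> simp <;> ring
  have hu2 : ∀ d : ℝ × ℝ, fderiv ℝ (fderiv ℝ u) (t, x) d d = e * d.1 ^ 2 + c * d.2 ^ 2 := by
    intro d
    have e1 : HasFDerivAt (fun r : ℝ × ℝ => b + e * (r.1 - t))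
        (e • ContinuousLinearMap.fst ℝ ℝ ℝ) (t, x) :=
      ((hasFDerivAt_fst.sub_const t).const_mul e).const_add b
    have e2 : HasFDerivAt (fun r : ℝ × ℝ => a + c * (r.2 - x))
        (c • ContinuousLinearMap.snd ℝ ℝ ℝ) (t, x) :=
      ((hasFDerivAt_snd.sub_const x).const_mul c).const_add a
    have e3 := (e1.smul_const (ContinuousLinearMap.fst ℝ ℝ ℝ)).add
      (e2.smul_const (ContinuousLinearMap.snd ℝ ℝ ℝ))
    have e4 := e3.fderiv
    rw [hu1]
    refine (congrArg (fun B => B d d) e4).trans ?_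
    simp
    ring
  set Γ : ℝ × ℝ → ℝ × ℝ × ℝ := fun r => (r.1, r.2, u r) with hΓdef
  have hΓq : Γ (t, x) = (t, x, w) := by simp [hΓdef, huq]
  have hΓ : ContDiffAt ℝ ∞ Γ (t, x) :=
    (contDiff_fst.prodMk (contDiff_snd.prodMk huc)).contDiffAt
  have hΓ1 : ∀ d : ℝ × ℝ, fderiv ℝ Γ (t, x) d = (d.1, d.2, b * d.1 + a * d.2) := by
    intro d
    have e1 : HasFDerivAt Γ ((ContinuousLinearMap.fst ℝ ℝ ℝ).prod
        ((ContinuousLinearMap.snd ℝ ℝ ℝ).prod (fderiv ℝ u (t, x)))) (t, x) :=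
      hasFDerivAt_fst.prodMk (hasFDerivAt_snd.prodMk
        (huc.differentiable (by simp) (t, x)).hasFDerivAt)
    rw [e1.fderiv, hu1]
    simp
  have hΓ2 : ∀ d : ℝ × ℝ, fderiv ℝ (fderiv ℝ Γ) (t, x) d d =
      (0, 0, e * d.1 ^ 2 + c * d.2 ^ 2) := by
    intro d
    have e0 : ∀ A : ℝ × ℝ →L[ℝ] ℝ, fderiv ℝ (fderiv ℝ A) (t, x) d d = 0 := by
      intro A
      have h1 : fderiv ℝ A = fun _ => A := funext fun _ => A.fderiv
      simp [h1]
    refine Prod.ext ?_ (Prod.ext ?_ ?_)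
    · exact (fderiv_fderiv_clm_comp (ContinuousLinearMap.fst ℝ ℝ (ℝ × ℝ)) hΓ d).symm.trans
        (e0 (ContinuousLinearMap.fst ℝ ℝ ℝ))
    · exact (fderiv_fderiv_clm_comp ((ContinuousLinearMap.fst ℝ ℝ ℝ).comp
        (ContinuousLinearMap.snd ℝ ℝ (ℝ × ℝ))) hΓ d).symm.trans
        (e0 (ContinuousLinearMap.snd ℝ ℝ ℝ))
    · exact (fderiv_fderiv_clm_comp ((ContinuousLinearMap.snd ℝ ℝ ℝ).comp
        (ContinuousLinearMap.snd ℝ ℝ (ℝ × ℝ))) hΓ d).symm.trans (hu2 d)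
  have hφp : ContDiffAt ℝ ∞ φ (Γ (t, x)) := by
    rw [hΓq]
    exact hφ.contDiffAt (hΩ.mem_nhds hp)
  have hψ : ContDiffAt ℝ ∞ (φ ∘ Γ) (t, x) := hφp.comp _ hΓ
  have hψ1 : ∀ d : ℝ × ℝ, fderiv ℝ (φ ∘ Γ) (t, x) d =
      fderiv ℝ φ (t, x, w) (d.1, d.2, b * d.1 + a * d.2) := by
    intro d
    rw [fderiv_comp _ (hφp.differentiableAt (by simp)) (hΓ.differentiableAt (by simp)),
      ContinuousLinearMap.comp_apply, hΓ1, hΓq]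
  have hψ2 : ∀ d : ℝ × ℝ, fderiv ℝ (fderiv ℝ (φ ∘ Γ)) (t, x) d d =
      fderiv ℝ (fderiv ℝ φ) (t, x, w) (d.1, d.2, b * d.1 + a * d.2)
        (d.1, d.2, b * d.1 + a * d.2) +
      fderiv ℝ φ (t, x, w) (0, 0, e * d.1 ^ 2 + c * d.2 ^ 2) := by
    intro d
    rw [fderiv_fderiv_comp hφp hΓ, hΓ1, hΓ2, hΓq]
  set π : ℝ × ℝ × ℝ →L[ℝ] ℝ × ℝ := (ContinuousLinearMap.fst ℝ ℝ (ℝ × ℝ)).prod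
    ((ContinuousLinearMap.fst ℝ ℝ ℝ).comp (ContinuousLinearMap.snd ℝ ℝ (ℝ × ℝ))) with hπ
  set ρ : ℝ × ℝ × ℝ →L[ℝ] ℝ := (ContinuousLinearMap.snd ℝ ℝ ℝ).comp
    (ContinuousLinearMap.snd ℝ ℝ (ℝ × ℝ)) with hρ
  have hni : newIndep φ u = fun r => π ((φ ∘ Γ) r) := rfl
  have hnd : newDep φ u = fun r => ρ ((φ ∘ Γ) r) := rfl
  have hni1 : ∀ d : ℝ × ℝ, fderiv ℝ (newIndep φ u) (t, x) d =
      π (fderiv ℝ φ (t, x, w) (d.1, d.2, b * d.1 + a * d.2)) := by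
    intro d
    rw [hni, fderiv_clm_comp π hψ, hψ1]
  have hnic : ContDiffAt ℝ ∞ (newIndep φ u) (t, x) := π.contDiff.contDiffAt.comp _ hψ
  -- The determinant is the expression in `hΔ`; the kernel is shown to vanish by Cramer's rule.
  have hdet : (fderiv ℝ (newIndep φ u) (t, x)).det ≠ 0 := by
    rw [det_ne_zero_iff_injective]
    refine (injective_iff_map_eq_zero _).2 fun d hd => ?_
    have h0 := hd
    rw [show d = d.1 • (1, 0) + d.2 • (0, 1) by simp, map_add, map_smul, map_smul, hni1,
      hni1] at h0
    have h1 := congrArg Prod.fst h0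
    have h2 := congrArg Prod.snd h0
    simp [hπ] at h1 h2
    refine Prod.ext ?_ ?_
    · refine (mul_eq_zero.1 ?_).resolve_right hΔ
      linear_combination (fderiv ℝ φ (t, x, w) (0, 1, a)).2.1 * h1 -
        (fderiv ℝ φ (t, x, w) (0, 1, a)).1 * h2
    · refine (mul_eq_zero.1 ?_).resolve_right hΔ
      linear_combination (fderiv ℝ φ (t, x, w) (1, 0, b)).1 * h2 -
        (fderiv ℝ φ (t, x, w) (1, 0, b)).2.1 * h1
  have hΓmem : ((t, x).1, (t, x).2, u (t, x)) ∈ Ω := by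
    simpa [huq] using hp
  obtain ⟨v, hv, hvu⟩ := exists_image_germ (φ := φ) (u := u) (q := (t, x)) hφp huc.contDiffAt hdet
  have hiff := h u v (t, x) hΓmem huc.contDiffAt hdet hv hvu
  rw [ArbElem.holdsAt_iff huc.contDiffAt, ArbElem.holdsAt_iff hv, hvu.self_of_nhds, huq, hu2,
    hu1] at hiff
  have hvu' : v ∘ newIndep φ u =ᶠ[𝓝 (t, x)] newDep φ u := hvu
  have hone : ∀ d : ℝ × ℝ, fderiv ℝ v (newIndep φ u (t, x)) (fderiv ℝ (newIndep φ u) (t, x) d) =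
      ρ (fderiv ℝ φ (t, x, w) (d.1, d.2, b * d.1 + a * d.2)) := by
    intro d
    rw [← hψ1, ← fderiv_clm_comp ρ hψ, ← hnd, ← hvu'.fderiv_eq,
      fderiv_comp _ (hv.differentiableAt (by simp)) (hnic.differentiableAt (by simp))]
    rfl
  have htwo : ∀ d : ℝ × ℝ,
      fderiv ℝ (fderiv ℝ v) (newIndep φ u (t, x)) (fderiv ℝ (newIndep φ u) (t, x) d)
        (fderiv ℝ (newIndep φ u) (t, x) d) +
      fderiv ℝ v (newIndep φ u (t, x)) (π (fderiv ℝ (fderiv ℝ (φ ∘ Γ)) (t, x) d d)) =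
      ρ (fderiv ℝ (fderiv ℝ (φ ∘ Γ)) (t, x) d d) := by
    intro d
    rw [← fderiv_fderiv_clm_comp ρ hψ, ← hnd, ← hvu'.fderiv.fderiv_eq,
      fderiv_fderiv_comp hv hnic, ← fderiv_fderiv_clm_comp π hψ, ← hni]
  refine ⟨fderiv ℝ v (newIndep φ u (t, x)) (1, 0), fderiv ℝ v (newIndep φ u (t, x)) (0, 1),
    fderiv ℝ (fderiv ℝ v) (newIndep φ u (t, x)) (0, 1) (0, 1), ?_, ?_, ?_, ?_⟩
  · have h1 := hone (1, 0)
    rw [hni1, hπ, ContinuousLinearMap.prod_apply, apply_prod_eq] at h1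
    simpa [hρ] using h1.symm
  · have h1 := hone (0, 1)
    rw [hni1, hπ, ContinuousLinearMap.prod_apply, apply_prod_eq] at h1
    simpa [hρ] using h1.symm
  -- A direction tangent to the graph and annihilated by `dT` is mapped to a multiple of `(0, 1)`.
  -- Of the second derivatives of `v`, only `v_XX` then survives in the second-order chain rule.
  · rintro d₁ d₂ J K hJ hK hJ1
    have h1 := htwo (d₁, d₂)
    rw [hψ2, ← hJ, ← hK, hni1, ← hJ, hπ, ContinuousLinearMap.prod_apply,
      ContinuousLinearMap.prod_apply, apply_prod_eq (fderiv ℝ v _)] at h1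
    have h2 : (((ContinuousLinearMap.fst ℝ ℝ (ℝ × ℝ)) (fderiv ℝ φ (t, x, w) J),
        ((ContinuousLinearMap.fst ℝ ℝ ℝ).comp (ContinuousLinearMap.snd ℝ ℝ (ℝ × ℝ)))
          (fderiv ℝ φ (t, x, w) J)) : ℝ × ℝ) = (fderiv ℝ φ (t, x, w) J).2.1 • (0, 1) := by
      simp [hJ1]
    rw [h2, map_smul, map_smul] at h1
    simp [hρ] at h1
    linear_combination -h1
  · have h1 : (newIndep φ u (t, x)).1 = (φ (t, x, w)).1 := by rw [← hΓq]; rfl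
    have h2 : newDep φ u (t, x) = (φ (t, x, w)).2.2 := by rw [← hΓq]; rfl
    rw [h1, h2] at hiff
    simpa using hiff

/-! ### Partial derivatives and the Jacobian in coordinates -/

/-- The unit vector of the space of `(t, x, u)` in the direction of `t`. -/
def et : ℝ × ℝ × ℝ := (1, 0, 0)

/-- The unit vector of the space of `(t, x, u)` in the direction of `x`. -/
def ex : ℝ × ℝ × ℝ := (0, 1, 0)

/-- The unit vector of the space of `(t, x, u)` in the direction of `u`. -/
def eu : ℝ × ℝ × ℝ := (0, 0, 1)

theorem triple_eq (x y z : ℝ) : ((x, y, z) : ℝ × ℝ × ℝ) = x • et + y • ex + z • eu := by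
  simp [et, ex, eu]

theorem pd_triple (f : ℝ × ℝ × ℝ → ℝ) (p : ℝ × ℝ × ℝ) (x y z : ℝ) :
    pd (x, y, z) f p = x * pd et f p + y * pd ex f p + z * pd eu f p := by
  simp [pd, triple_eq x y z]

/-- The Jacobian of a map of `ℝ³` in terms of the partial derivatives of its components. -/
theorem jacobian_ne_zero {φ : ℝ × ℝ × ℝ → ℝ × ℝ × ℝ} {p : ℝ × ℝ × ℝ} {T X U : ℝ × ℝ × ℝ → ℝ}
    (hT : ∀ v, pd v T p = (fderiv ℝ φ p v).1) (hX : ∀ v, pd v X p = (fderiv ℝ φ p v).2.1)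
    (hU : ∀ v, pd v U p = (fderiv ℝ φ p v).2.2) (hdet : (fderiv ℝ φ p).det ≠ 0) :
    pd et T p * (pd ex X p * pd eu U p - pd eu X p * pd ex U p) -
      pd ex T p * (pd et X p * pd eu U p - pd eu X p * pd et U p) +
      pd eu T p * (pd et X p * pd ex U p - pd ex X p * pd et U p) ≠ 0 := by
  have hinj := (det_ne_zero_iff_injective _).1 hdet
  have hsurj : Function.Surjective (fderiv ℝ φ p : ℝ × ℝ × ℝ →ₗ[ℝ] ℝ × ℝ × ℝ) :=
    LinearMap.injective_iff_surjective.1 hinj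
  -- The preimages of the unit vectors are the columns of the inverse Jacobian matrix.
  obtain ⟨⟨a1, a2, a3⟩, ha⟩ := hsurj et
  obtain ⟨⟨b1, b2, b3⟩, hb⟩ := hsurj ex
  obtain ⟨⟨c1, c2, c3⟩, hc⟩ := hsurj eu
  have key : ∀ (y1 y2 y3 : ℝ) (z : ℝ × ℝ × ℝ),
      (fderiv ℝ φ p : ℝ × ℝ × ℝ →ₗ[ℝ] ℝ × ℝ × ℝ) (y1, y2, y3) = z →
      y1 * pd et T p + y2 * pd ex T p + y3 * pd eu T p = z.1 ∧
      y1 * pd et X p + y2 * pd ex X p + y3 * pd eu X p = z.2.1 ∧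
      y1 * pd et U p + y2 * pd ex U p + y3 * pd eu U p = z.2.2 := by
    intro y1 y2 y3 z hz
    rw [← pd_triple, ← pd_triple, ← pd_triple, hT, hX, hU, ← hz]
    exact ⟨rfl, rfl, rfl⟩
  obtain ⟨ha1, ha2, ha3⟩ := key _ _ _ _ ha
  obtain ⟨hb1, hb2, hb3⟩ := key _ _ _ _ hb
  obtain ⟨hc1, hc2, hc3⟩ := key _ _ _ _ hc
  have hM : !![pd et T p, pd ex T p, pd eu T p; pd et X p, pd ex X p, pd eu X p;
      pd et U p, pd ex U p, pd eu U p] * !![a1, b1, c1; a2, b2, c2; a3, b3, c3] = 1 := by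
    simp only [et, ex, eu] at *
    ext i j
    fin_cases i <;> fin_cases j <;> simp [Matrix.mul_apply, Fin.sum_univ_three] <;> linarith
  have hd := congrArg Matrix.det hM
  rw [Matrix.det_mul, Matrix.det_one] at hd
  have hne := left_ne_zero_of_mul (hd.trans_ne one_ne_zero)
  rw [Matrix.det_fin_three] at hne
  simp at hne
  intro h0
  apply hne
  linear_combination h0

/-- Each of the two nonzero affine functions of `a` has at most one root, so one of the values `0,
1, 2` is a root of neither. -/
theorem exists_ne_zero_and_ne_zero {f₀ f₁ h₀ h₁ : ℝ} (hf : f₀ ≠ 0 ∨ f₁ ≠ 0)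
    (hh : h₀ ≠ 0 ∨ h₁ ≠ 0) : ∃ a : ℝ, f₀ + a * f₁ ≠ 0 ∧ h₀ + a * h₁ ≠ 0 := by
  by_contra hcon
  push Not at hcon
  have key : ∀ a, f₀ + a * f₁ = 0 ∨ h₀ + a * h₁ = 0 := fun a =>
    or_iff_not_imp_left.2 (hcon a)
  rcases key 0 with h0 | h0 <;> rcases key 1 with h1 | h1 <;> rcases key 2 with h2 | h2 <;>
    first
    | (rcases hf with hf | hf <;> apply hf <;> linarith)
    | (rcases hh with hh | hh <;> apply hh <;> linarith)

/-! ### The new time depends on the old time only -/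

section PointTransf

variable {θ θ' : ArbElem} {Ω : Set (ℝ × ℝ × ℝ)} {φ : ℝ × ℝ × ℝ → ℝ × ℝ × ℝ}
  {T X U : ℝ × ℝ × ℝ → ℝ}

theorem exists_prolonged_jet_pd (h : MapsEquation θ θ' Ω φ) (hφ : IsPointTransf Ω φ)
    (hTXU : φ = fun q => (T q, X q, U q)) {p : ℝ × ℝ × ℝ} (hp : p ∈ Ω) (a b c e : ℝ)
    (hΔ : (pd et T p + b * pd eu T p) * (pd ex X p + a * pd eu X p) -
      (pd ex T p + a * pd eu T p) * (pd et X p + b * pd eu X p) ≠ 0) :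
    ∃ vT vX vXX : ℝ,
      pd et U p + b * pd eu U p =
        vT * (pd et T p + b * pd eu T p) + vX * (pd et X p + b * pd eu X p) ∧
      pd ex U p + a * pd eu U p =
        vT * (pd ex T p + a * pd eu T p) + vX * (pd ex X p + a * pd eu X p) ∧
      (∀ d₁ d₂ κ : ℝ, ∀ J : ℝ × ℝ × ℝ, J = (d₁, d₂, b * d₁ + a * d₂) →
        κ = e * d₁ ^ 2 + c * d₂ ^ 2 → pd J T p = 0 →
        pd J (pd J U) p + κ * pd eu U p = vXX * (pd J X p) ^ 2 +
          vT * (pd J (pd J T) p + κ * pd eu T p) + vX * (pd J (pd J X) p + κ * pd eu X p)) ∧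
      (b + p.2.2 ^ θ.n * a = θ.g p.1 * c ↔ vT + U p ^ θ'.n * vX = θ'.g (T p) * vXX) := by
  obtain ⟨hΩ, hφ, -⟩ := hφ
  have hφp : ContDiffAt ℝ ∞ φ p := hφ.contDiffAt (hΩ.mem_nhds hp)
  have hTe : T = fun q => (ContinuousLinearMap.fst ℝ ℝ (ℝ × ℝ)) (φ q) := by rw [hTXU]; rfl
  have hXe : X = fun q => ((ContinuousLinearMap.fst ℝ ℝ ℝ).comp
    (ContinuousLinearMap.snd ℝ ℝ (ℝ × ℝ))) (φ q) := by rw [hTXU]; rfl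
  have hUe : U = fun q => ((ContinuousLinearMap.snd ℝ ℝ ℝ).comp
    (ContinuousLinearMap.snd ℝ ℝ (ℝ × ℝ))) (φ q) := by rw [hTXU]; rfl
  have hTs : ContDiffOn ℝ ∞ T Ω := hTe ▸ hφ.fst
  have hXs : ContDiffOn ℝ ∞ X Ω := hXe ▸ hφ.snd.fst
  have hUs : ContDiffOn ℝ ∞ U Ω := hUe ▸ hφ.snd.snd
  have hT1 : ∀ v, pd v T p = (fderiv ℝ φ p v).1 := fun v => by
    rw [pd, hTe, fderiv_clm_comp _ hφp]; rfl
  have hX1 : ∀ v, pd v X p = (fderiv ℝ φ p v).2.1 := fun v => by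
    rw [pd, hXe, fderiv_clm_comp _ hφp]; rfl
  have hU1 : ∀ v, pd v U p = (fderiv ℝ φ p v).2.2 := fun v => by
    rw [pd, hUe, fderiv_clm_comp _ hφp]; rfl
  have hT2 : ∀ v, pd v (pd v T) p = (fderiv ℝ (fderiv ℝ φ) p v v).1 := fun v => by
    rw [← fderiv_fderiv_eq_pd_pd hΩ hTs hp, hTe, fderiv_fderiv_clm_comp _ hφp]; rfl
  have hX2 : ∀ v, pd v (pd v X) p = (fderiv ℝ (fderiv ℝ φ) p v v).2.1 := fun v => by
    rw [← fderiv_fderiv_eq_pd_pd hΩ hXs hp, hXe, fderiv_fderiv_clm_comp _ hφp]; rfl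
  have hU2 : ∀ v, pd v (pd v U) p = (fderiv ℝ (fderiv ℝ φ) p v v).2.2 := fun v => by
    rw [← fderiv_fderiv_eq_pd_pd hΩ hUs hp, hUe, fderiv_fderiv_clm_comp _ hφp]; rfl
  have hb : ∀ f : ℝ × ℝ × ℝ → ℝ, pd et f p + b * pd eu f p = pd (1, 0, b) f p := fun f => by
    rw [pd_triple f p 1 0 b]; ring
  have ha : ∀ f : ℝ × ℝ × ℝ → ℝ, pd ex f p + a * pd eu f p = pd (0, 1, a) f p := fun f => by
    rw [pd_triple f p 0 1 a]; ring
  have hκ : ∀ (κ : ℝ) (f : ℝ × ℝ × ℝ → ℝ), κ * pd eu f p = pd (0, 0, κ) f p := fun κ f => by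
    rw [pd_triple f p 0 0 κ]; ring
  have hφe : φ p = (T p, X p, U p) := by rw [hTXU]
  simp only [hb, ha] at hΔ ⊢
  simp only [hκ]
  simp only [hT1, hX1, hU1, hT2, hX2, hU2] at hΔ ⊢
  obtain ⟨vT, vX, vXX, h1, h2, h3, h4⟩ := exists_prolonged_jet h hΩ hφ hp a b c e hΔ
  rw [hφe] at h4
  refine ⟨vT, vX, vXX, h1, h2, ?_, h4⟩
  intro d₁ d₂ κ J hJ hκe hJT
  have h5 := h3 d₁ d₂ J _ hJ rfl hJT
  rw [← hκe] at h5
  simpa using h5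

/-- The components of a point transformation, its equations having nonvanishing coefficients. -/
structure IsTransfBetween (θ θ' : ArbElem) (Ω : Set (ℝ × ℝ × ℝ))
    (T X U : ℝ × ℝ × ℝ → ℝ) : Prop where
  transf : IsPointTransf Ω fun q => (T q, X q, U q)
  maps : MapsEquation θ θ' Ω fun q => (T q, X q, U q)
  g_ne : ∀ q ∈ Ω, θ.g q.1 ≠ 0
  g_ne' : ∀ q ∈ Ω, θ'.g (T q) ≠ 0

namespace IsTransfBetween

theorem contDiffOn_T (h : IsTransfBetween θ θ' Ω T X U) : ContDiffOn ℝ ∞ T Ω := h.transf.2.1.fst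

theorem contDiffOn_X (h : IsTransfBetween θ θ' Ω T X U) : ContDiffOn ℝ ∞ X Ω :=
  h.transf.2.1.snd.fst

theorem contDiffOn_U (h : IsTransfBetween θ θ' Ω T X U) : ContDiffOn ℝ ∞ U Ω :=
  h.transf.2.1.snd.snd

theorem jacobian (h : IsTransfBetween θ θ' Ω T X U) {p : ℝ × ℝ × ℝ} (hp : p ∈ Ω) :
    pd et T p * (pd ex X p * pd eu U p - pd eu X p * pd ex U p) -
      pd ex T p * (pd et X p * pd eu U p - pd eu X p * pd et U p) +
      pd eu T p * (pd et X p * pd ex U p - pd ex X p * pd et U p) ≠ 0 := by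
  have hφp : ContDiffAt ℝ ∞ (fun q => (T q, X q, U q)) p :=
    h.transf.2.1.contDiffAt (h.transf.1.mem_nhds hp)
  exact jacobian_ne_zero (φ := fun q => (T q, X q, U q))
    (fun v => fderiv_clm_comp (ContinuousLinearMap.fst ℝ ℝ (ℝ × ℝ)) hφp v)
    (fun v => fderiv_clm_comp ((ContinuousLinearMap.fst ℝ ℝ ℝ).comp
      (ContinuousLinearMap.snd ℝ ℝ (ℝ × ℝ))) hφp v)
    (fun v => fderiv_clm_comp ((ContinuousLinearMap.snd ℝ ℝ ℝ).comp
      (ContinuousLinearMap.snd ℝ ℝ (ℝ × ℝ))) hφp v) (h.transf.2.2 p hp)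

/-- The new time depends only on the old one: otherwise the second derivative of `u` with respect
to `t`, which the equation does not restrict, would enter the transformed equation. -/
theorem pd_T_eq_zero (h : IsTransfBetween θ θ' Ω T X U) {p : ℝ × ℝ × ℝ} (hp : p ∈ Ω) :
    pd ex T p = 0 ∧ pd eu T p = 0 := by
  by_contra hcon
  have hT : pd ex T p ≠ 0 ∨ pd eu T p ≠ 0 := by
    rw [not_and_or] at hcon
    exact hcon
  have hjac := h.jacobian hp
  -- The terms with `a b` cancel in the second expression, so it is affine in `(a, b)`; the
  -- coefficient of `b` is `T_u X_x - T_x X_u`. If this coefficient vanishes, the Jacobian condition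
  -- makes the expression a nonzero affine function of `a`. Otherwise `b` is chosen so that the
  -- expression equals `1`.
  obtain ⟨a, b, hPx, hΔ⟩ : ∃ a b : ℝ, pd ex T p + a * pd eu T p ≠ 0 ∧
      (pd et T p + b * pd eu T p) * (pd ex X p + a * pd eu X p) -
        (pd ex T p + a * pd eu T p) * (pd et X p + b * pd eu X p) ≠ 0 := by
    by_cases hM : pd eu T p * pd ex X p - pd ex T p * pd eu X p = 0
    · have hM' : pd et T p * pd ex X p - pd ex T p * pd et X p ≠ 0 ∨
          pd et T p * pd eu X p - pd eu T p * pd et X p ≠ 0 := by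
        by_contra hc
        push Not at hc
        apply hjac
        linear_combination pd eu U p * hc.1 - pd ex U p * hc.2 - pd et U p * hM
      obtain ⟨a, ha, hb⟩ := exists_ne_zero_and_ne_zero hT hM'
      refine ⟨a, 0, ha, fun h0 => hb ?_⟩
      linear_combination h0
    · obtain ⟨a, ha, -⟩ := exists_ne_zero_and_ne_zero hT hT
      have hb := div_mul_cancel₀ (1 - (pd et T p * pd ex X p - pd ex T p * pd et X p) -
        a * (pd et T p * pd eu X p - pd eu T p * pd et X p)) hM
      refine ⟨a, (1 - (pd et T p * pd ex X p - pd ex T p * pd et X p) -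
        a * (pd et T p * pd eu X p - pd eu T p * pd et X p)) /
        (pd eu T p * pd ex X p - pd ex T p * pd eu X p), ha, ?_⟩
      refine ne_of_eq_of_ne ?_ one_ne_zero
      linear_combination hb
  -- This `u_xx` puts the jet on the equation manifold, whatever `u_tt` is. The values `0` and `1`
  -- of `u_tt` are compared: the first derivatives of the image agree, hence so does `v_XX` by the
  -- target equation.
  set c : ℝ := (b + p.2.2 ^ θ.n * a) / θ.g p.1 with hc
  have hcg : b + p.2.2 ^ θ.n * a = θ.g p.1 * c := by
    rw [hc, mul_div_cancel₀ _ (h.g_ne p hp)]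
  obtain ⟨vT, vX, vXX, h1, h2, h3, h4⟩ :=
    exists_prolonged_jet_pd h.maps h.transf rfl hp a b c 0 hΔ
  obtain ⟨wT, wX, wXX, k1, k2, k3, k4⟩ :=
    exists_prolonged_jet_pd h.maps h.transf rfl hp a b c 1 hΔ
  have hT' : wT = vT := by
    apply mul_right_cancel₀ hΔ
    linear_combination (pd ex X p + a * pd eu X p) * (h1 - k1) -
      (pd et X p + b * pd eu X p) * (h2 - k2)
  have hX' : wX = vX := by
    apply mul_right_cancel₀ hΔ
    linear_combination (pd et T p + b * pd eu T p) * (h2 - k2) -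
      (pd ex T p + a * pd eu T p) * (h1 - k1)
  subst hT' hX'
  have hXX' : wXX = vXX := by
    apply mul_left_cancel₀ (h.g_ne' p hp)
    rw [← h4.1 hcg, ← k4.1 hcg]
  subst hXX'
  -- The direction is `D_x T · D_t - D_t T · D_x`, which annihilates `T`. Its `t`-component `D_x T`
  -- is nonzero, so `u_tt` does enter the relation for `v_XX`.
  have hJT : pd (pd ex T p + a * pd eu T p, -(pd et T p + b * pd eu T p),
      b * (pd ex T p + a * pd eu T p) + a * -(pd et T p + b * pd eu T p)) T p = 0 := by
    rw [pd_triple]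
    ring
  have h5 := h3 _ _ _ _ rfl rfl hJT
  have k5 := k3 _ _ _ _ rfl rfl hJT
  have h6 : pd eu U p = wT * pd eu T p + wX * pd eu X p := by
    apply mul_left_cancel₀ (pow_ne_zero 2 hPx)
    linear_combination k5 - h5
  -- The gradient of `U` is now a linear combination of those of `T` and `X`.
  apply hjac
  have h7 : pd et U p = wT * pd et T p + wX * pd et X p := by linear_combination h1 - b * h6
  have h8 : pd ex U p = wT * pd ex T p + wX * pd ex X p := by linear_combination h2 - a * h6
  rw [h6, h7, h8]
  ring

end IsTransfBetween

end PointTransf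

/-! ### The determining equations -/

theorem pd_pd_slope {Ω : Set (ℝ × ℝ × ℝ)} {f : ℝ × ℝ × ℝ → ℝ} (hΩ : IsOpen Ω)
    (hf : ContDiffOn ℝ ∞ f Ω) {p : ℝ × ℝ × ℝ} (hp : p ∈ Ω) (a : ℝ) :
    pd (0, 1, a) (pd (0, 1, a) f) p =
      pd ex (pd ex f) p + 2 * a * pd ex (pd eu f) p + a ^ 2 * pd eu (pd eu f) p := by
  have hJ : ((0, 1, a) : ℝ × ℝ × ℝ) = ex + a • eu := by simp [ex, eu]
  have h := pd_comm hΩ hf hp eu ex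
  rw [hJ, ← fderiv_fderiv_eq_pd_pd hΩ hf hp]
  simp only [map_add, map_smul, add_apply, smul_apply, smul_eq_mul,
    fderiv_fderiv_eq_pd_pd hΩ hf hp]
  rw [h]
  ring

namespace IsTransfBetween

variable {θ θ' : ArbElem} {Ω : Set (ℝ × ℝ × ℝ)} {T X U : ℝ × ℝ × ℝ → ℝ}

theorem pd_slope_T (h : IsTransfBetween θ θ' Ω T X U) {p : ℝ × ℝ × ℝ} (hp : p ∈ Ω) (a : ℝ) :
    pd (0, 1, a) T p = 0 := by
  rw [pd_triple, (h.pd_T_eq_zero hp).1, (h.pd_T_eq_zero hp).2]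
  ring

theorem jacobian' (h : IsTransfBetween θ θ' Ω T X U) {p : ℝ × ℝ × ℝ} (hp : p ∈ Ω) :
    pd et T p ≠ 0 ∧ pd ex X p * pd eu U p - pd eu X p * pd ex U p ≠ 0 := by
  have hjac := h.jacobian hp
  rw [(h.pd_T_eq_zero hp).1, (h.pd_T_eq_zero hp).2] at hjac
  simpa using hjac

/-- With `T_x = T_u = 0` the direction `D_x` itself annihilates `T` and no longer involves `u_tt`.
The source equation eliminates `u_t`, leaving `a = u_x` and `c = u_xx` as free parameters. -/
theorem exists_jet (h : IsTransfBetween θ θ' Ω T X U) {p : ℝ × ℝ × ℝ} (hp : p ∈ Ω) (a c : ℝ)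
    (ha : pd ex X p + a * pd eu X p ≠ 0) :
    ∃ vT vX vXX : ℝ,
      pd et U p + (θ.g p.1 * c - p.2.2 ^ θ.n * a) * pd eu U p =
        vT * pd et T p + vX * (pd et X p + (θ.g p.1 * c - p.2.2 ^ θ.n * a) * pd eu X p) ∧
      pd ex U p + a * pd eu U p = vX * (pd ex X p + a * pd eu X p) ∧
      pd (0, 1, a) (pd (0, 1, a) U) p + c * pd eu U p =
        vXX * (pd ex X p + a * pd eu X p) ^ 2 +
          vX * (pd (0, 1, a) (pd (0, 1, a) X) p + c * pd eu X p) ∧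
      vT + U p ^ θ'.n * vX = θ'.g (T p) * vXX := by
  obtain ⟨hTx, hTu⟩ := h.pd_T_eq_zero hp
  have hΔ : (pd et T p + (θ.g p.1 * c - p.2.2 ^ θ.n * a) * pd eu T p) *
      (pd ex X p + a * pd eu X p) - (pd ex T p + a * pd eu T p) *
        (pd et X p + (θ.g p.1 * c - p.2.2 ^ θ.n * a) * pd eu X p) ≠ 0 := by
    rw [hTx, hTu]
    simpa using ⟨(h.jacobian' hp).1, ha⟩
  obtain ⟨vT, vX, vXX, h1, h2, h3, h4⟩ :=
    exists_prolonged_jet_pd h.maps h.transf rfl hp a _ c 0 hΔ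
  refine ⟨vT, vX, vXX, ?_, ?_, ?_, h4.1 (by ring)⟩
  · rw [hTu] at h1
    linear_combination h1
  · rw [hTu, hTx] at h2
    linear_combination h2
  · have h5 := h3 0 1 c (0, 1, a) (by simp) (by ring) (h.pd_slope_T hp a)
    rw [pd_eq_zero h.transf.1 hp (fun q hq => h.pd_slope_T hq a), hTu] at h5
    have h6 : pd (0, 1, a) X p = pd ex X p + a * pd eu X p := by
      rw [pd_triple X p 0 1 a]
      ring
    rw [h6] at h5
    linear_combination h5

/-- This is the coefficient of `u_xx`: the relations for `u_xx = 0` and `u_xx = 1` share `v_X`, and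
their difference carries the factor `U_u - v_X X_u`, which the Jacobian keeps away from zero. -/
theorem g_mul_sq (h : IsTransfBetween θ θ' Ω T X U) {p : ℝ × ℝ × ℝ} (hp : p ∈ Ω) {a : ℝ}
    (ha : pd ex X p + a * pd eu X p ≠ 0) :
    θ.g p.1 * (pd ex X p + a * pd eu X p) ^ 2 = θ'.g (T p) * pd et T p := by
  obtain ⟨vT, vX, vXX, h1, h2, h3, h4⟩ := h.exists_jet hp a 0 ha
  obtain ⟨wT, wX, wXX, k1, k2, k3, k4⟩ := h.exists_jet hp a 1 ha
  have hX : wX = vX := by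
    apply mul_right_cancel₀ ha
    rw [← h2, ← k2]
  subst hX
  have hw : pd eu U p - wX * pd eu X p ≠ 0 := by
    intro h0
    apply (h.jacobian' hp).2
    linear_combination (pd ex X p + a * pd eu X p) * h0 - pd eu X p * h2
  apply mul_left_cancel₀ hw
  linear_combination (pd ex X p + a * pd eu X p) ^ 2 * (k1 - h1) +
    pd et T p * (pd ex X p + a * pd eu X p) ^ 2 * (k4 - h4) -
    θ'.g (T p) * pd et T p * (k3 - h3)

/-- The right-hand side of `g_mul_sq` does not depend on `u_x`. If `X_u ≠ 0`, then `D_x X` could be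
given both values `1` and `2`, forcing `g = 4 g`. -/
theorem pd_eu_X (h : IsTransfBetween θ θ' Ω T X U) {p : ℝ × ℝ × ℝ} (hp : p ∈ Ω) :
    pd eu X p = 0 := by
  by_contra hX
  have h1 : pd ex X p + (1 - pd ex X p) / pd eu X p * pd eu X p = 1 := by
    rw [div_mul_cancel₀ _ hX]
    ring
  have h2 : pd ex X p + (2 - pd ex X p) / pd eu X p * pd eu X p = 2 := by
    rw [div_mul_cancel₀ _ hX]
    ring
  have k1 := h.g_mul_sq hp (h1.trans_ne one_ne_zero)
  have k2 := h.g_mul_sq hp (h2.trans_ne two_ne_zero)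
  rw [h1] at k1
  rw [h2] at k2
  apply h.g_ne p hp
  linarith

theorem pd_X_ne_zero (h : IsTransfBetween θ θ' Ω T X U) {p : ℝ × ℝ × ℝ} (hp : p ∈ Ω) :
    pd ex X p ≠ 0 ∧ pd eu U p ≠ 0 := by
  have h1 := (h.jacobian' hp).2
  rw [h.pd_eu_X hp] at h1
  simpa using h1

theorem g_mul_pd_X_sq (h : IsTransfBetween θ θ' Ω T X U) {p : ℝ × ℝ × ℝ} (hp : p ∈ Ω) :
    θ.g p.1 * pd ex X p ^ 2 = θ'.g (T p) * pd et T p := by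
  simpa using h.g_mul_sq hp (a := 0) (by simpa using (h.pd_X_ne_zero hp).1)

/-- The determining equations, obtained by splitting with respect to `u_x`. -/
theorem determining (h : IsTransfBetween θ θ' Ω T X U) {p : ℝ × ℝ × ℝ} (hp : p ∈ Ω) :
    pd eu (pd eu U) p = 0 ∧
    U p ^ θ'.n * pd et T p * pd eu U p = pd ex X p * p.2.2 ^ θ.n * pd eu U p +
      pd et X p * pd eu U p + 2 * θ.g p.1 * pd ex X p * pd ex (pd eu U) p -
      θ.g p.1 * pd eu U p * pd ex (pd ex X) p ∧
    pd ex X p * pd et U p - pd ex U p * pd et X p + U p ^ θ'.n * pd et T p * pd ex U p =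
      θ.g p.1 * pd ex X p * pd ex (pd ex U) p - θ.g p.1 * pd ex U p * pd ex (pd ex X) p := by
  have hX := (h.pd_X_ne_zero hp).1
  have hXu := h.pd_eu_X hp
  have hg := h.g_mul_pd_X_sq hp
  have hΩ := h.transf.1
  have hXxu : pd ex (pd eu X) p = 0 := pd_eq_zero hΩ hp (fun q hq => h.pd_eu_X hq) ex
  have hXuu : pd eu (pd eu X) p = 0 := pd_eq_zero hΩ hp (fun q hq => h.pd_eu_X hq) eu
  have key : ∀ a : ℝ, pd ex X p * (pd et U p - p.2.2 ^ θ.n * a * pd eu U p) -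
      (pd ex U p + a * pd eu U p) * pd et X p +
      U p ^ θ'.n * pd et T p * (pd ex U p + a * pd eu U p) =
      θ.g p.1 * pd ex X p * (pd ex (pd ex U) p + 2 * a * pd ex (pd eu U) p +
        a ^ 2 * pd eu (pd eu U) p) -
      θ.g p.1 * (pd ex U p + a * pd eu U p) * pd ex (pd ex X) p := by
    intro a
    obtain ⟨vT, vX, vXX, h1, h2, h3, h4⟩ := h.exists_jet hp a 0 (by simpa [hXu] using hX)
    rw [pd_pd_slope hΩ h.contDiffOn_U hp, pd_pd_slope hΩ h.contDiffOn_X hp, hXxu, hXuu, hXu] at h3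
    rw [hXu] at h1 h2
    linear_combination pd ex X p * h1 + (U p ^ θ'.n * pd et T p - pd et X p -
      - θ.g p.1 * pd ex (pd ex X) p) * h2 + pd ex X p * pd et T p * h4 -
      θ.g p.1 * pd ex X p * h3 - pd ex X p * vXX * hg
  -- A polynomial of degree two in `u_x` is split by its values at `0, 1, -1`.
  have k0 := key 0
  have k1 := key 1
  have k2 := key (-1)
  refine ⟨?_, ?_, ?_⟩
  · apply mul_left_cancel₀ (mul_ne_zero (h.g_ne p hp) hX)
    linear_combination k0 - k1 / 2 - k2 / 2
  · linear_combination (k1 - k2) / 2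
  · linear_combination k0

end IsTransfBetween

/-! ### Integration of the determining equations -/

theorem is_const_of_pd_eq_zero {Ω : Set (ℝ × ℝ × ℝ)} {f : ℝ × ℝ × ℝ → ℝ} (hΩ : IsOpen Ω)
    (hΩ' : IsConnected Ω) (hf : ContDiffOn ℝ ∞ f Ω) (ht : ∀ q ∈ Ω, pd et f q = 0)
    (hx : ∀ q ∈ Ω, pd ex f q = 0) (hu : ∀ q ∈ Ω, pd eu f q = 0) : ∃ c, ∀ q ∈ Ω, f q = c := by
  obtain ⟨p, hp⟩ := hΩ'.nonempty
  refine ⟨f p, fun q hq => ?_⟩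
  refine hΩ.is_const_of_fderiv_eq_zero hΩ'.isPreconnected (hf.differentiableOn (by simp)) ?_ hq hp
  intro r hr
  refine ContinuousLinearMap.ext fun v => ?_
  obtain ⟨x, y, z⟩ := v
  have h := pd_triple f r x y z
  rw [ht r hr, hx r hr, hu r hr] at h
  simpa [pd] using h

theorem pd_sub_clm {E : Type*} [NormedAddCommGroup E] [NormedSpace ℝ E] {f : E → ℝ} {p : E}
    (hf : DifferentiableAt ℝ f p) (A : E →L[ℝ] ℝ) (v : E) :
    pd v (fun q => f q - A q) p = pd v f p - A v := by
  have h := (hf.hasFDerivAt.sub A.hasFDerivAt).fderiv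
  exact congrArg (fun B : E →L[ℝ] ℝ => B v) h

namespace IsTransfBetween

variable {θ θ' : ArbElem} {Ω : Set (ℝ × ℝ × ℝ)} {T X U : ℝ × ℝ × ℝ → ℝ}

/-- In `g X_x² = g̃(T) T_t` everything except `X_x` depends on `t` only, so differentiation with
respect to `x` leaves `2 g X_x X_xx = 0`. -/
theorem pd_ex_ex_X (h : IsTransfBetween θ θ' Ω T X U)
    (hg : ∀ q ∈ Ω, DifferentiableAt ℝ θ'.g (T q)) {p : ℝ × ℝ × ℝ} (hp : p ∈ Ω) :
    pd ex (pd ex X) p = 0 := by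
  have hΩ := h.transf.1
  have hT := h.contDiffOn_T
  have hX := h.contDiffOn_X
  have h0 : ∀ r : ℝ, (p + r • ex).1 = p.1 := fun r => by simp [ex]
  have hg0 : HasDerivAt (fun r : ℝ => θ.g (p + r • ex).1) 0 0 := by
    simpa only [h0] using hasDerivAt_const 0 (θ.g p.1)
  have h1 := hg0.mul ((hasDerivAt_pd hΩ (contDiffOn_pd hΩ hX ex) hp ex).pow 2)
  have hgp : HasDerivAt θ'.g (deriv θ'.g (T p)) (T (p + (0 : ℝ) • ex)) := by
    simpa using (hg p hp).hasDerivAt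
  have h2 : HasDerivAt (fun r : ℝ => θ'.g (T (p + r • ex)) * pd et T (p + r • ex)) _ 0 :=
    (hgp.comp 0 (hasDerivAt_pd hΩ hT hp ex)).mul
      (hasDerivAt_pd hΩ (contDiffOn_pd hΩ hT et) hp ex)
  have h3 := lineDeriv_unique hΩ hp (fun q hq => h.g_mul_pd_X_sq hq) h1 h2
  rw [(h.pd_T_eq_zero hp).1, pd_comm hΩ hT hp ex et,
    pd_eq_zero hΩ hp (fun q hq => (h.pd_T_eq_zero hq).1) et] at h3
  simpa [h.g_ne p hp, (h.pd_X_ne_zero hp).1] using h3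

/-- The `u`-derivative of the coefficient of `u_x` in the determining relation: since `U_uu = 0` and
`X_u = T_u = 0`, only the powers `U^ñ` and `u^n` contribute. A common factor `U_u` is cancelled. -/
theorem pd_eu_determining (h : IsTransfBetween θ θ' Ω T X U)
    (hg : ∀ q ∈ Ω, DifferentiableAt ℝ θ'.g (T q)) (hu : ∀ q ∈ Ω, 0 < q.2.2)
    (hU : ∀ q ∈ Ω, 0 < U q) {p : ℝ × ℝ × ℝ} (hp : p ∈ Ω) :
    θ'.n * U p ^ (θ'.n - 1) * pd eu U p * pd et T p =
      θ.n * pd ex X p * p.2.2 ^ (θ.n - 1) := by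
  have hΩ := h.transf.1
  have hT := h.contDiffOn_T
  have hX := h.contDiffOn_X
  have hUs := h.contDiffOn_U
  have hE : ∀ q ∈ Ω, U q ^ θ'.n * pd et T q * pd eu U q =
      pd ex X q * q.2.2 ^ θ.n * pd eu U q + pd et X q * pd eu U q +
        2 * θ.g q.1 * pd ex X q * pd ex (pd eu U) q := by
    intro q hq
    have := (h.determining hq).2.1
    rw [h.pd_ex_ex_X hg hq] at this
    linear_combination this
  have h0 : ∀ r : ℝ, (p + r • eu).1 = p.1 := fun r => by simp [eu]
  have hu1 : HasDerivAt (fun r : ℝ => (p + r • eu).2.2) 1 0 := by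
    simpa [eu] using (hasDerivAt_id (0 : ℝ)).const_add p.2.2
  have hU1 := hasDerivAt_pd hΩ hUs hp eu
  have hU2 := hasDerivAt_pd hΩ (contDiffOn_pd hΩ hUs eu) hp eu
  have hX2 := hasDerivAt_pd hΩ (contDiffOn_pd hΩ hX ex) hp eu
  have hX1 := hasDerivAt_pd hΩ (contDiffOn_pd hΩ hX et) hp eu
  have hT1 := hasDerivAt_pd hΩ (contDiffOn_pd hΩ hT et) hp eu
  have hU3 := hasDerivAt_pd hΩ (contDiffOn_pd hΩ (contDiffOn_pd hΩ hUs eu) ex) hp eu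
  rw [pd_comm hΩ (contDiffOn_pd hΩ hUs eu) hp eu ex,
    pd_eq_zero hΩ hp (fun q hq => (h.determining hq).1)] at hU3
  rw [(h.determining hp).1] at hU2
  rw [pd_comm hΩ hX hp, pd_eq_zero hΩ hp (fun q hq => h.pd_eu_X hq)] at hX1 hX2
  rw [pd_comm hΩ hT hp, pd_eq_zero hΩ hp (fun q hq => (h.pd_T_eq_zero hq).2)] at hT1
  have hl := ((hU1.rpow_const (p := θ'.n) (.inl (by simpa using (hU p hp).ne'))).mul hT1).mul hU2
  have hg0 : HasDerivAt (fun r : ℝ => θ.g (p + r • eu).1) 0 0 := by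
    simpa only [h0] using hasDerivAt_const 0 (θ.g p.1)
  have hr := (((hX2.mul (hu1.rpow_const (p := θ.n) (.inl (by simpa using (hu p hp).ne')))).mul
    hU2).add (hX1.mul hU2)).add (((hg0.const_mul 2).mul hX2).mul hU3)
  have hfin := lineDeriv_unique hΩ hp hE hl hr
  simp at hfin
  linear_combination hfin.resolve_right (h.pd_X_ne_zero hp).2

/-- The logarithmic `u`-derivative of `pd_eu_determining`, cleared of denominators; `n ≠ 0` makes
both sides of that relation nonzero. -/
theorem pd_eu_pd_eu_determining (h : IsTransfBetween θ θ' Ω T X U)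
    (hg : ∀ q ∈ Ω, DifferentiableAt ℝ θ'.g (T q)) (hu : ∀ q ∈ Ω, 0 < q.2.2)
    (hU : ∀ q ∈ Ω, 0 < U q) (hn : θ.n ≠ 0) {p : ℝ × ℝ × ℝ} (hp : p ∈ Ω) :
    (θ'.n - 1) * pd eu U p * p.2.2 = (θ.n - 1) * U p := by
  have hΩ := h.transf.1
  have hT := h.contDiffOn_T
  have hX := h.contDiffOn_X
  have hUs := h.contDiffOn_U
  have hE := fun q hq => h.pd_eu_determining hg hu hU (p := q) hq
  have hu1 : HasDerivAt (fun r : ℝ => (p + r • eu).2.2) 1 0 := by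
    simpa [eu] using (hasDerivAt_id (0 : ℝ)).const_add p.2.2
  have hU1 := hasDerivAt_pd hΩ hUs hp eu
  have hU2 := hasDerivAt_pd hΩ (contDiffOn_pd hΩ hUs eu) hp eu
  have hX2 := hasDerivAt_pd hΩ (contDiffOn_pd hΩ hX ex) hp eu
  have hT1 := hasDerivAt_pd hΩ (contDiffOn_pd hΩ hT et) hp eu
  rw [(h.determining hp).1] at hU2
  rw [pd_comm hΩ hX hp, pd_eq_zero hΩ hp (fun q hq => h.pd_eu_X hq)] at hX2
  rw [pd_comm hΩ hT hp, pd_eq_zero hΩ hp (fun q hq => (h.pd_T_eq_zero hq).2)] at hT1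
  have hl := (((hU1.rpow_const (p := θ'.n - 1)
    (.inl (by simpa using (hU p hp).ne'))).const_mul θ'.n).mul hU2).mul hT1
  have hr := (hX2.const_mul θ.n).mul
    (hu1.rpow_const (p := θ.n - 1) (.inl (by simpa using (hu p hp).ne')))
  have hfin := lineDeriv_unique hΩ hp hE hl hr
  simp at hfin
  have hUp := Real.rpow_sub_one (hU p hp).ne' (θ'.n - 1)
  have hup := Real.rpow_sub_one (hu p hp).ne' (θ.n - 1)
  rw [hUp, hup] at hfin
  have hU0 := (hU p hp).ne'
  have hu0 := (hu p hp).ne'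
  field_simp at hfin
  have h1 : θ.n * pd ex X p * p.2.2 ^ (θ.n - 1) ≠ 0 :=
    mul_ne_zero (mul_ne_zero hn (h.pd_X_ne_zero hp).1) (Real.rpow_pos_of_pos (hu p hp) _).ne'
  apply mul_left_cancel₀ h1
  linear_combination hfin - (θ'.n - 1) * pd eu U p * p.2.2 * hE p hp

/-- One more `u`-derivative gives `(ñ - 1) U_u = (n - 1) U_u`. The argument covers `n = 1` as well.
-/
theorem n_eq (h : IsTransfBetween θ θ' Ω T X U)
    (hg : ∀ q ∈ Ω, DifferentiableAt ℝ θ'.g (T q)) (hu : ∀ q ∈ Ω, 0 < q.2.2)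
    (hU : ∀ q ∈ Ω, 0 < U q) (hn : θ.n ≠ 0) (hΩ' : Ω.Nonempty) : θ'.n = θ.n := by
  obtain ⟨p, hp⟩ := hΩ'
  have hΩ := h.transf.1
  have hUs := h.contDiffOn_U
  have hE := fun q hq => h.pd_eu_pd_eu_determining hg hu hU hn (p := q) hq
  have hu1 : HasDerivAt (fun r : ℝ => (p + r • eu).2.2) 1 0 := by
    simpa [eu] using (hasDerivAt_id (0 : ℝ)).const_add p.2.2
  have hU1 := hasDerivAt_pd hΩ hUs hp eu
  have hU2 := hasDerivAt_pd hΩ (contDiffOn_pd hΩ hUs eu) hp eu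
  rw [(h.determining hp).1] at hU2
  have hfin := lineDeriv_unique hΩ hp hE ((hU2.const_mul (θ'.n - 1)).mul hu1)
    (hU1.const_mul (θ.n - 1))
  simp at hfin
  exact hfin.resolve_right (h.pd_X_ne_zero hp).2

/-- Here `n ≠ 1` enters: the factor `n - 1` is cancelled on both sides of `pd_eu_pd_eu_determining`,
which for `n = 1` would be the empty condition `0 = 0`. -/
theorem U_eq (h : IsTransfBetween θ θ' Ω T X U)
    (hg : ∀ q ∈ Ω, DifferentiableAt ℝ θ'.g (T q)) (hu : ∀ q ∈ Ω, 0 < q.2.2)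
    (hU : ∀ q ∈ Ω, 0 < U q) (hn : θ.n ≠ 0) (hn' : θ.n ≠ 1) {p : ℝ × ℝ × ℝ} (hp : p ∈ Ω) :
    U p = p.2.2 * pd eu U p ∧ 0 < pd eu U p := by
  have h1 := h.pd_eu_pd_eu_determining hg hu hU hn hp
  rw [h.n_eq hg hu hU hn ⟨p, hp⟩] at h1
  have h2 : U p = p.2.2 * pd eu U p := by
    apply mul_left_cancel₀ (sub_ne_zero.2 hn')
    linear_combination -h1
  exact ⟨h2, pos_of_mul_pos_right (h2 ▸ hU p hp) (hu p hp).le⟩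

theorem rpow_mul_pd_T (h : IsTransfBetween θ θ' Ω T X U)
    (hg : ∀ q ∈ Ω, DifferentiableAt ℝ θ'.g (T q)) (hu : ∀ q ∈ Ω, 0 < q.2.2)
    (hU : ∀ q ∈ Ω, 0 < U q) (hn : θ.n ≠ 0) (hn' : θ.n ≠ 1) {p : ℝ × ℝ × ℝ} (hp : p ∈ Ω) :
    pd eu U p ^ θ.n * pd et T p = pd ex X p := by
  obtain ⟨h1, h2⟩ := h.U_eq hg hu hU hn hn' hp
  have h3 := h.pd_eu_determining hg hu hU hp
  rw [h.n_eq hg hu hU hn ⟨p, hp⟩, h1, Real.mul_rpow (hu p hp).le h2.le,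
    Real.rpow_sub_one h2.ne'] at h3
  have h4 : θ.n * p.2.2 ^ (θ.n - 1) ≠ 0 :=
    mul_ne_zero hn (Real.rpow_pos_of_pos (hu p hp) _).ne'
  apply mul_left_cancel₀ h4
  have h5 := h2.ne'
  field_simp at h3
  linear_combination θ.n * h3

/-- In `U_u^n T_t = X_x` neither `T_t` nor `X_x` depends on `x`. -/
theorem pd_ex_eu_U (h : IsTransfBetween θ θ' Ω T X U)
    (hg : ∀ q ∈ Ω, DifferentiableAt ℝ θ'.g (T q)) (hu : ∀ q ∈ Ω, 0 < q.2.2)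
    (hU : ∀ q ∈ Ω, 0 < U q) (hn : θ.n ≠ 0) (hn' : θ.n ≠ 1) {p : ℝ × ℝ × ℝ} (hp : p ∈ Ω) :
    pd ex (pd eu U) p = 0 := by
  have hΩ := h.transf.1
  have hT := h.contDiffOn_T
  obtain ⟨-, h2⟩ := h.U_eq hg hu hU hn hn' hp
  have hT1 := hasDerivAt_pd hΩ (contDiffOn_pd hΩ hT et) hp ex
  rw [pd_comm hΩ hT hp, pd_eq_zero hΩ hp (fun q hq => (h.pd_T_eq_zero hq).1)] at hT1
  have hU2 := hasDerivAt_pd hΩ (contDiffOn_pd hΩ h.contDiffOn_U eu) hp ex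
  have hX2 := hasDerivAt_pd hΩ (contDiffOn_pd hΩ h.contDiffOn_X ex) hp ex
  rw [h.pd_ex_ex_X hg hp] at hX2
  have hfin := lineDeriv_unique hΩ hp (fun q hq => h.rpow_mul_pd_T hg hu hU hn hn' hq)
    ((hU2.rpow_const (p := θ.n) (.inl (by simpa using h2.ne'))).mul hT1) hX2
  simpa [hn, (Real.rpow_pos_of_pos h2 _).ne', (h.jacobian' hp).1] using hfin

theorem pd_ex_U (h : IsTransfBetween θ θ' Ω T X U)
    (hg : ∀ q ∈ Ω, DifferentiableAt ℝ θ'.g (T q)) (hu : ∀ q ∈ Ω, 0 < q.2.2)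
    (hU : ∀ q ∈ Ω, 0 < U q) (hn : θ.n ≠ 0) (hn' : θ.n ≠ 1) {p : ℝ × ℝ × ℝ} (hp : p ∈ Ω) :
    pd ex U p = 0 := by
  have hΩ := h.transf.1
  have hu1 : HasDerivAt (fun r : ℝ => (p + r • ex).2.2) 0 0 := by
    simpa [ex] using hasDerivAt_const (0 : ℝ) p.2.2
  have hU2 := hasDerivAt_pd hΩ (contDiffOn_pd hΩ h.contDiffOn_U eu) hp ex
  rw [h.pd_ex_eu_U hg hu hU hn hn' hp] at hU2
  have hfin := lineDeriv_unique hΩ hp (fun q hq => (h.U_eq hg hu hU hn hn' hq).1)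
    (hasDerivAt_pd hΩ h.contDiffOn_U hp ex) (hu1.mul hU2)
  simpa using hfin

/-- In the coefficient of `u_x`, the terms with `u^n` cancel by `rpow_mul_pd_T`, so only `X_t U_u`
is left. -/
theorem pd_et_X (h : IsTransfBetween θ θ' Ω T X U)
    (hg : ∀ q ∈ Ω, DifferentiableAt ℝ θ'.g (T q)) (hu : ∀ q ∈ Ω, 0 < q.2.2)
    (hU : ∀ q ∈ Ω, 0 < U q) (hn : θ.n ≠ 0) (hn' : θ.n ≠ 1) {p : ℝ × ℝ × ℝ} (hp : p ∈ Ω) :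
    pd et X p = 0 := by
  have h1 := (h.determining hp).2.1
  obtain ⟨h2, h3⟩ := h.U_eq hg hu hU hn hn' hp
  rw [h.pd_ex_ex_X hg hp, h.pd_ex_eu_U hg hu hU hn hn' hp, h.n_eq hg hu hU hn ⟨p, hp⟩, h2,
    Real.mul_rpow (hu p hp).le h3.le] at h1
  apply mul_right_cancel₀ h3.ne'
  linear_combination -h1 + p.2.2 ^ θ.n * pd eu U p * h.rpow_mul_pd_T hg hu hU hn hn' hp

theorem pd_et_U (h : IsTransfBetween θ θ' Ω T X U)
    (hg : ∀ q ∈ Ω, DifferentiableAt ℝ θ'.g (T q)) (hu : ∀ q ∈ Ω, 0 < q.2.2)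
    (hU : ∀ q ∈ Ω, 0 < U q) (hn : θ.n ≠ 0) (hn' : θ.n ≠ 1) {p : ℝ × ℝ × ℝ} (hp : p ∈ Ω) :
    pd et U p = 0 := by
  have h1 := (h.determining hp).2.2
  rw [h.pd_ex_U hg hu hU hn hn' hp, pd_eq_zero h.transf.1 hp
    (fun q hq => h.pd_ex_U hg hu hU hn hn' hq)] at h1
  simpa [(h.pd_X_ne_zero hp).1] using h1

/-- Integration of the determining equations. -/
theorem exists_affine (h : IsTransfBetween θ θ' Ω T X U) (hΩ' : IsConnected Ω)
    (hg : ∀ q ∈ Ω, DifferentiableAt ℝ θ'.g (T q)) (hu : ∀ q ∈ Ω, 0 < q.2.2)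
    (hU : ∀ q ∈ Ω, 0 < U q) (hn : θ.n ≠ 0) (hn' : θ.n ≠ 1) :
    ∃ α β δ₁ δ₀ : ℝ, 0 < α * δ₁ ∧ ∀ q ∈ Ω, T q = α * q.1 + β ∧ X q = δ₁ * q.2.1 + δ₀ ∧
      U q = (δ₁ / α) ^ (1 / θ.n) * q.2.2 ∧ θ'.g (T q) = δ₁ ^ 2 / α * θ.g q.1 := by
  have hΩ := h.transf.1
  have hT := h.contDiffOn_T
  have hX := h.contDiffOn_X
  have hUs := h.contDiffOn_U
  obtain ⟨p, hp⟩ := id hΩ'.nonempty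
  obtain ⟨A, hA⟩ := is_const_of_pd_eq_zero hΩ hΩ' (contDiffOn_pd hΩ hUs eu)
    (fun q hq => by
      rw [pd_comm hΩ hUs hq, pd_eq_zero hΩ hq (fun q hq => h.pd_et_U hg hu hU hn hn' hq)])
    (fun q hq => h.pd_ex_eu_U hg hu hU hn hn' hq) (fun q hq => (h.determining hq).1)
  obtain ⟨δ₁, hδ⟩ := is_const_of_pd_eq_zero hΩ hΩ' (contDiffOn_pd hΩ hX ex)
    (fun q hq => by
      rw [pd_comm hΩ hX hq, pd_eq_zero hΩ hq (fun q hq => h.pd_et_X hg hu hU hn hn' hq)])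
    (fun q hq => h.pd_ex_ex_X hg hq)
    (fun q hq => by
      rw [pd_comm hΩ hX hq, pd_eq_zero hΩ hq (fun q hq => h.pd_eu_X hq)])
  have hA0 : 0 < A := hA p hp ▸ (h.U_eq hg hu hU hn hn' hp).2
  have hAn : 0 < A ^ θ.n := Real.rpow_pos_of_pos hA0 _
  have hα : ∀ q ∈ Ω, pd et T q = δ₁ / A ^ θ.n := fun q hq => by
    have h1 := h.rpow_mul_pd_T hg hu hU hn hn' hq
    rw [hA q hq, hδ q hq] at h1
    rw [← h1, mul_div_cancel_left₀ _ hAn.ne']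
  -- With `A = U_u`, the relation `A^n T_t = X_x` fixes `T_t`. Positivity of `A` then gives both the
  -- sign condition on `α δ₁` and the root `A = (δ₁ / α)^(1/n)`.
  set α : ℝ := δ₁ / A ^ θ.n with hαdef
  have hδ0 : δ₁ ≠ 0 := hδ p hp ▸ (h.pd_X_ne_zero hp).1
  have hα0 : α ≠ 0 := div_ne_zero hδ0 hAn.ne'
  have hAα : δ₁ / α = A ^ θ.n := by
    rw [hαdef]
    field_simp
  have hTd : ∀ q ∈ Ω, DifferentiableAt ℝ T q := fun q hq =>
    (hT.contDiffAt (hΩ.mem_nhds hq)).differentiableAt (by simp)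
  have hXd : ∀ q ∈ Ω, DifferentiableAt ℝ X q := fun q hq =>
    (hX.contDiffAt (hΩ.mem_nhds hq)).differentiableAt (by simp)
  set B : ℝ × ℝ × ℝ →L[ℝ] ℝ := α • ContinuousLinearMap.fst ℝ ℝ (ℝ × ℝ) with hB
  set C : ℝ × ℝ × ℝ →L[ℝ] ℝ := δ₁ • (ContinuousLinearMap.fst ℝ ℝ ℝ).comp
    (ContinuousLinearMap.snd ℝ ℝ (ℝ × ℝ)) with hC
  obtain ⟨β, hβ⟩ := is_const_of_pd_eq_zero (f := fun q => T q - B q) hΩ hΩ'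
    (hT.sub B.contDiff.contDiffOn)
    (fun q hq => by rw [pd_sub_clm (hTd q hq), hα q hq]; simp [hB, et])
    (fun q hq => by rw [pd_sub_clm (hTd q hq), (h.pd_T_eq_zero hq).1]; simp [hB, ex])
    (fun q hq => by rw [pd_sub_clm (hTd q hq), (h.pd_T_eq_zero hq).2]; simp [hB, eu])
  obtain ⟨δ₀, hδ₀⟩ := is_const_of_pd_eq_zero (f := fun q => X q - C q) hΩ hΩ'
    (hX.sub C.contDiff.contDiffOn)
    (fun q hq => by rw [pd_sub_clm (hXd q hq), h.pd_et_X hg hu hU hn hn' hq]; simp [hC, et])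
    (fun q hq => by rw [pd_sub_clm (hXd q hq), hδ q hq]; simp [hC, ex])
    (fun q hq => by rw [pd_sub_clm (hXd q hq), h.pd_eu_X hq]; simp [hC, eu])
  refine ⟨α, β, δ₁, δ₀, ?_, fun q hq => ⟨?_, ?_, ?_, ?_⟩⟩
  · have h1 : α * δ₁ = δ₁ ^ 2 / A ^ θ.n := by rw [hαdef]; ring
    rw [h1]
    positivity
  · have h1 : T q - α * q.1 = β := hβ q hq
    linarith
  · have h1 : X q - δ₁ * q.2.1 = δ₀ := hδ₀ q hq
    linarith
  · rw [hAα, ← Real.rpow_mul hA0.le, mul_one_div_cancel hn, Real.rpow_one,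
      (h.U_eq hg hu hU hn hn' hq).1, hA q hq, mul_comm]
  · have h1 := h.g_mul_pd_X_sq hq
    rw [hα q hq, hδ q hq] at h1
    field_simp
    linear_combination -h1

end IsTransfBetween

/-- The admissible transformations of the class, unless `n = 1` for the source equation. -/
theorem Admissible.exists_affTransf {N : Set ℝ} (hN : N ⊆ allExponents) {θ θ' : ArbElem}
    {Ω : Set (ℝ × ℝ × ℝ)} {φ : ℝ × ℝ × ℝ → ℝ × ℝ × ℝ} (h : Admissible N θ θ' Ω φ)
    (hn : θ.n ≠ 1) :
    θ'.n = θ.n ∧ ∃ α β δ₁ δ₀ : ℝ, 0 < α * δ₁ ∧ Induces (ext N) (affTransf α β δ₁ δ₀) θ θ' Ω φ := by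
  obtain ⟨⟨hd, hdc, hgs, hg0, hnN⟩, ⟨hd', hdc', hgs', hg0', hnN'⟩, hΩ', hΩp, hφp, hφ, hmaps⟩ := h
  have ht : IsTransfBetween θ θ' Ω (fun q => (φ q).1) (fun q => (φ q).2.1) (fun q => (φ q).2.2) :=
    ⟨hφ, hmaps, fun q hq => hg0 _ (hΩp hq).1, fun q hq => hg0' _ (hφp hq).1⟩
  have hg : ∀ q ∈ Ω, DifferentiableAt ℝ θ'.g (φ q).1 := fun q hq =>
    (hgs'.contDiffAt (hd'.mem_nhds (hφp hq).1)).differentiableAt (by simp)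
  have hu : ∀ q ∈ Ω, 0 < q.2.2 := fun q hq => (hΩp hq).2
  have hU : ∀ q ∈ Ω, 0 < (φ q).2.2 := fun q hq => (hφp hq).2
  have hn0 : θ.n ≠ 0 := hN hnN
  have hnn := ht.n_eq hg hu hU hn0 hΩ'.nonempty
  obtain ⟨α, β, δ₁, δ₀, hpos, hall⟩ := ht.exists_affine hΩ' hg hu hU hn0 hn
  refine ⟨hnn, α, β, δ₁, δ₀, hpos, fun q hq => ⟨⟨hu q hq, hg0 _ (hΩp hq).1, hnN⟩, ?_⟩⟩
  obtain ⟨h1, h2, h3, h4⟩ := hall q hq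
  simp only [affTransf, ArbElem.lift, nCoord, hnn, h4, h3, h2]
  rw [← h1]

/-! ### The affine transformations belong to the group -/

theorem det_fderiv_ne_zero_of_leftInverse {E : Type*} [NormedAddCommGroup E] [NormedSpace ℝ E]
    [FiniteDimensional ℝ E] {f g : E → E} {p : E} (hf : DifferentiableAt ℝ f p)
    (hg : DifferentiableAt ℝ g (f p)) (h : ∀ᶠ q in 𝓝 p, g (f q) = q) :
    (fderiv ℝ f p).det ≠ 0 := by
  rw [det_ne_zero_iff_injective]
  have h1 : fderiv ℝ (g ∘ f) p = fderiv ℝ id p := Filter.EventuallyEq.fderiv_eq h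
  rw [fderiv_comp p hg hf, fderiv_id] at h1
  refine Function.LeftInverse.injective (g := fderiv ℝ g (f p)) fun v => ?_
  exact congrArg (fun B : E →L[ℝ] E => B v) h1

theorem affine_rpow {α δ₁ n : ℝ} (h : 0 < α * δ₁) (hn : n ≠ 0) :
    0 < δ₁ / α ∧ 0 < (δ₁ / α) ^ (1 / n) ∧ ((δ₁ / α) ^ (1 / n)) ^ n = δ₁ / α := by
  have h0 : 0 < δ₁ / α := by
    rw [div_eq_mul_inv, mul_comm]
    rcases pos_and_pos_or_neg_and_neg_of_mul_pos h with ⟨h1, h2⟩ | ⟨h1, h2⟩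
    · positivity
    · exact mul_pos_of_neg_of_neg (inv_lt_zero.2 h1) h2
  refine ⟨h0, Real.rpow_pos_of_pos h0 _, ?_⟩
  rw [← Real.rpow_mul h0.le, one_div_mul_cancel hn, Real.rpow_one]

/-- Since `v_T = (A/α) u_t`, `v_X = (A/δ₁) u_x` and `v_XX = (A/δ₁²) u_xx`, the condition `A^n =
δ₁/α` makes every term of the target equation `A/α` times the corresponding term of the source
equation. -/
theorem mapsEquation_affine {θ θ' : ArbElem} {Ω : Set (ℝ × ℝ × ℝ)} {α β δ₁ δ₀ A : ℝ}
    (hα : α ≠ 0) (hδ : δ₁ ≠ 0) (hA : 0 < A) (hAn : A ^ θ.n = δ₁ / α) (hn : θ'.n = θ.n)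
    (hu : ∀ q ∈ Ω, 0 < q.2.2) (hg : ∀ q ∈ Ω, θ'.g (α * q.1 + β) = δ₁ ^ 2 / α * θ.g q.1) :
    MapsEquation θ θ' Ω fun q => (α * q.1 + β, δ₁ * q.2.1 + δ₀, A * q.2.2) := by
  intro u v q hq huc _ hv huv
  rw [ArbElem.holdsAt_iff huc, ArbElem.holdsAt_iff hv, huv.self_of_nhds, hn]
  simp only [newIndep, newDep] at hv huv ⊢
  rw [hg _ hq, Real.mul_rpow hA.le (hu _ hq).le, hAn]
  set ψ : ℝ × ℝ → ℝ × ℝ := fun r => (α * r.1 + β, δ₁ * r.2 + δ₀) with hψ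
  replace hv : ContDiffAt ℝ ∞ v (ψ q) := hv
  set L : ℝ × ℝ →L[ℝ] ℝ × ℝ := (α • ContinuousLinearMap.fst ℝ ℝ ℝ).prod
    (δ₁ • ContinuousLinearMap.snd ℝ ℝ ℝ) with hL
  have hψ1 : ∀ r, HasFDerivAt ψ L r := fun r =>
    ((hasFDerivAt_fst.const_mul α).add_const β).prodMk ((hasFDerivAt_snd.const_mul δ₁).add_const δ₀)
  have hψ2 : fderiv ℝ ψ = fun _ => L := funext fun r => (hψ1 r).fderiv
  have hψc : ContDiffAt ℝ ∞ ψ q := by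
    rw [hψ]
    fun_prop
  have huv' : v ∘ ψ =ᶠ[𝓝 q] fun r => (A • ContinuousLinearMap.id ℝ ℝ) (u r) := huv
  have hone : ∀ d, fderiv ℝ v (ψ q) (L d) = A * fderiv ℝ u q d := fun d => by
    have h1 := fderiv_clm_comp (A • ContinuousLinearMap.id ℝ ℝ) huc d
    rw [← huv'.fderiv_eq, fderiv_comp _ (hv.differentiableAt (by simp))
      (hψ1 q).differentiableAt, hψ2] at h1
    simpa using h1
  have htwo : ∀ d, fderiv ℝ (fderiv ℝ v) (ψ q) (L d) (L d) =
      A * fderiv ℝ (fderiv ℝ u) q d d := fun d => by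
    have h1 := fderiv_fderiv_clm_comp (A • ContinuousLinearMap.id ℝ ℝ) huc d
    rw [← huv'.fderiv.fderiv_eq, fderiv_fderiv_comp hv hψc, hψ2] at h1
    simpa using h1
  have ht := hone (1, 0)
  have hx := hone (0, 1)
  have hxx := htwo (0, 1)
  have e1 : L (1, 0) = α • (1, 0) := by simp [hL]
  have e2 : L (0, 1) = δ₁ • (0, 1) := by simp [hL]
  rw [e1, map_smul, smul_eq_mul] at ht
  rw [e2, map_smul, smul_eq_mul] at hx
  rw [e2, map_smul, map_smul, smul_apply, smul_eq_mul, smul_eq_mul] at hxx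
  have hA0 := hA.ne'
  have k1 : fderiv ℝ v (ψ q) (1, 0) = A / α * fderiv ℝ u q (1, 0) := by
    field_simp
    linear_combination ht
  have k2 : fderiv ℝ v (ψ q) (0, 1) = A / δ₁ * fderiv ℝ u q (0, 1) := by
    field_simp
    linear_combination hx
  have k3 : fderiv ℝ (fderiv ℝ v) (ψ q) (0, 1) (0, 1) =
      A / δ₁ ^ 2 * fderiv ℝ (fderiv ℝ u) q (0, 1) (0, 1) := by
    field_simp
    linear_combination hxx
  rw [k1, k2, k3]
  rw [← mul_right_inj' (div_ne_zero hA0 hα)]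
  refine Eq.congr ?_ ?_ <;> field_simp

theorem contDiffOn_affTransf {D : Set ExtSpace} {α β δ₁ δ₀ : ExtSpace → ℝ}
    (hα : ContDiffOn ℝ ∞ α D) (hβ : ContDiffOn ℝ ∞ β D) (hδ₁ : ContDiffOn ℝ ∞ δ₁ D)
    (hδ₀ : ContDiffOn ℝ ∞ δ₀ D) (hpos : ∀ p ∈ D, 0 < α p * δ₁ p) (hn : ∀ p ∈ D, nCoord p ≠ 0) :
    ContDiffOn ℝ ∞ (fun p => affTransf (α p) (β p) (δ₁ p) (δ₀ p) p) D := by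
  have hα0 : ∀ p ∈ D, α p ≠ 0 := fun p hp => left_ne_zero_of_mul (hpos p hp).ne'
  have hnc : ContDiffOn ℝ ∞ nCoord D := by
    unfold nCoord
    fun_prop
  have hpow : ContDiffOn ℝ ∞ (fun p => (δ₁ p / α p) ^ (1 / nCoord p)) D := by
    refine ContDiffOn.rpow (hδ₁.div hα hα0) (contDiffOn_const.div hnc hn) fun p hp => ?_
    exact (affine_rpow (hpos p hp) (hn p hp)).1.ne'
  have h1 : ContDiffOn ℝ ∞ (fun p : ExtSpace => p.1) D := by fun_prop
  have h2 : ContDiffOn ℝ ∞ (fun p : ExtSpace => p.2.1) D := by fun_prop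
  have h3 : ContDiffOn ℝ ∞ (fun p : ExtSpace => p.2.2.1) D := by fun_prop
  have h4 : ContDiffOn ℝ ∞ (fun p : ExtSpace => p.2.2.2.1) D := by fun_prop
  exact ((hα.mul h1).add hβ).prodMk (((hδ₁.mul h2).add hδ₀).prodMk ((hpow.mul h3).prodMk
    ((((hδ₁.pow 2).div hα hα0).mul h4).prodMk hnc)))

theorem affTransf_inv {α β δ₁ δ₀ : ℝ} (h : 0 < α * δ₁) {p : ExtSpace} (hn : nCoord p ≠ 0) :
    affTransf (1 / α) (-β / α) (1 / δ₁) (-δ₀ / δ₁) (affTransf α β δ₁ δ₀ p) = p := by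
  obtain ⟨t, x, u, g, n⟩ := p
  have hα : α ≠ 0 := left_ne_zero_of_mul h.ne'
  have hδ : δ₁ ≠ 0 := right_ne_zero_of_mul h.ne'
  obtain ⟨h1, h2, h3⟩ := affine_rpow h hn
  have h4 : (1 / δ₁ / (1 / α)) = (δ₁ / α)⁻¹ := by field_simp
  simp only [affTransf, nCoord, h4, Prod.mk.injEq] at *
  rw [Real.inv_rpow h1.le]
  have h5 := h2.ne'
  refine ⟨?_, ?_, ?_, ?_, trivial⟩
  · field_simp
    ring
  · field_simp
    ring
  · rw [inv_mul_cancel_left₀ h5]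
  · field_simp

theorem isOpenMap_nCoord : IsOpenMap nCoord :=
  isOpenMap_snd.comp (isOpenMap_snd.comp (isOpenMap_snd.comp isOpenMap_snd))

theorem contDiff_nCoord : ContDiff ℝ ∞ nCoord := by
  unfold nCoord
  fun_prop

theorem continuousOn_lift {θ : ArbElem} (hg : ContinuousOn θ.g θ.dom) :
    ContinuousOn θ.lift θ.phase := by
  have h1 : ContinuousOn (fun q : ℝ × ℝ × ℝ => θ.g q.1) θ.phase :=
    hg.comp continuousOn_fst fun q hq => hq.1
  unfold ArbElem.lift
  fun_prop

theorem isOpen_phase {θ : ArbElem} (h : IsOpen θ.dom) : IsOpen θ.phase :=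
  (h.preimage continuous_fst).inter 
    (isOpen_lt continuous_const (continuous_snd.comp continuous_snd))

theorem inGenEquivGroup_affTransf {N : Set ℝ} (hN : N ⊆ allExponents) {D : Set ExtSpace}
    {Φ : ExtSpace → ExtSpace} (hD : IsOpen D) (hDN : D ⊆ ext N) {α β δ₁ δ₀ : ℝ → ℝ}
    (hα : ContDiffOn ℝ ∞ α (nCoord '' D)) (hβ : ContDiffOn ℝ ∞ β (nCoord '' D))
    (hδ₁ : ContDiffOn ℝ ∞ δ₁ (nCoord '' D)) (hδ₀ : ContDiffOn ℝ ∞ δ₀ (nCoord '' D))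
    (hpos : ∀ n ∈ nCoord '' D, 0 < α n * δ₁ n)
    (hΦ : ∀ p ∈ D, Φ p = affTransf (α (nCoord p)) (β (nCoord p)) (δ₁ (nCoord p))
      (δ₀ (nCoord p)) p) : InGenEquivGroup N D Φ := by
  have hn0 : ∀ p ∈ D, nCoord p ≠ 0 := fun p hp => hN (hDN hp).2.2
  have hpos' : ∀ p ∈ D, 0 < α (nCoord p) * δ₁ (nCoord p) := fun p hp =>
    hpos _ (mem_image_of_mem _ hp)
  have hsmooth : ContDiffOn ℝ ∞ Φ D := by
    refine ContDiffOn.congr ?_ hΦ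
    have hm : MapsTo nCoord D (nCoord '' D) := mapsTo_image _ _
    exact contDiffOn_affTransf (hα.comp contDiff_nCoord.contDiffOn hm)
      (hβ.comp contDiff_nCoord.contDiffOn hm) (hδ₁.comp contDiff_nCoord.contDiffOn hm)
      (hδ₀.comp contDiff_nCoord.contDiffOn hm) hpos' hn0
  refine ⟨hDN, ?_, ⟨hD, hsmooth, ?_⟩, ?_⟩
  · intro p hp
    obtain ⟨h1, h2, h3⟩ := hDN hp
    have hp0 := hpos' p hp
    rw [hΦ p hp]
    refine ⟨mul_pos (affine_rpow hp0 (hn0 p hp)).2.1 h1, mul_ne_zero (div_ne_zero (pow_ne_zero _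
      (right_ne_zero_of_mul hp0.ne')) (left_ne_zero_of_mul hp0.ne')) h2, h3⟩
  · intro p hp
    -- The inverse has parameters depending on `n`, which are smooth over the projection of `D`. It
    -- is therefore considered on the whole cylinder over this projection, which contains `Φ p`
    -- because `Φ` preserves `n`.
    set D' : Set ExtSpace := nCoord ⁻¹' (nCoord '' D) with hD'
    have hD'o : IsOpen D' := (isOpenMap_nCoord D hD).preimage contDiff_nCoord.continuous
    have hm : MapsTo nCoord D' (nCoord '' D) := fun q hq => hq
    have hα0 : ∀ n ∈ nCoord '' D, α n ≠ 0 := fun n hn => left_ne_zero_of_mul (hpos n hn).ne'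
    have hδ0 : ∀ n ∈ nCoord '' D, δ₁ n ≠ 0 := fun n hn => right_ne_zero_of_mul (hpos n hn).ne'
    have hinv := contDiffOn_affTransf (D := D')
      ((contDiffOn_const (c := (1 : ℝ)).div hα hα0).comp contDiff_nCoord.contDiffOn hm)
      ((hβ.neg.div hα hα0).comp contDiff_nCoord.contDiffOn hm)
      ((contDiffOn_const (c := (1 : ℝ)).div hδ₁ hδ0).comp contDiff_nCoord.contDiffOn hm)
      ((hδ₀.neg.div hδ₁ hδ0).comp contDiff_nCoord.contDiffOn hm)
      (fun q hq => by
        have := hpos _ hq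
        change 0 < 1 / α (nCoord q) * (1 / δ₁ (nCoord q))
        rw [one_div_mul_one_div]
        positivity)
      (by
        rintro q ⟨r, hr, hrq⟩
        exact hrq ▸ hn0 r hr)
    have hΦn : ∀ q ∈ D, nCoord (Φ q) = nCoord q := fun q hq => by
      rw [hΦ q hq]
      rfl
    have hΦp : Φ p ∈ D' := by
      rw [hD', mem_preimage, hΦn p hp]
      exact mem_image_of_mem _ hp
    refine det_fderiv_ne_zero_of_leftInverse
      ((hsmooth.contDiffAt (hD.mem_nhds hp)).differentiableAt (by simp))
      ((hinv.contDiffAt (hD'o.mem_nhds hΦp)).differentiableAt (by simp)) ?_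
    filter_upwards [hD.mem_nhds hp] with q hq
    simp only [Function.comp_apply, Pi.div_apply, hΦn q hq]
    rw [hΦ q hq]
    exact affTransf_inv (hpos' q hq) (hn0 q hq)
  · intro θ hθ q hq hqD
    obtain ⟨hd, hdc, hgs, hg0, hnN⟩ := id hθ
    have hn : θ.n ≠ 0 := hN hnN
    have hp0 : 0 < α θ.n * δ₁ θ.n := hpos' _ hqD
    -- For a fixed equation `n` is a number, so the parameters become constants.
    generalize ha : α θ.n = a at hp0
    generalize hb : β θ.n = b
    generalize hc : δ₁ θ.n = c at hp0
    generalize he : δ₀ θ.n = e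
    have ha0 := left_ne_zero_of_mul hp0.ne'
    have hc0 := right_ne_zero_of_mul hp0.ne'
    obtain ⟨h1, h2, h3⟩ := affine_rpow hp0 hn
    set A := (c / a) ^ (1 / θ.n)
    have hopen : IsOpen (θ.phase ∩ θ.lift ⁻¹' D) :=
      (continuousOn_lift hgs.continuousOn).isOpen_inter_preimage (isOpen_phase hd) hD
    -- A ball serves as `Ω`, since the domain of an admissible transformation has to be connected.
    obtain ⟨ε, hε, hball⟩ := Metric.isOpen_iff.1 hopen q ⟨hq, hqD⟩
    set θ' : ArbElem := ⟨(fun s => (s - b) / a) ⁻¹' θ.dom,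
      fun s => c ^ 2 / a * θ.g ((s - b) / a), θ.n⟩ with hθ'
    have hcancel : ∀ t, (a * t + b - b) / a = t := fun t => by field_simp; ring
    have hcont : Continuous fun s : ℝ => (s - b) / a := by fun_prop
    have hθ'c : θ'.InClass N := by
      refine ⟨hd.preimage hcont, ?_, ?_, ?_, hnN⟩
      · have himage : θ'.dom = (fun t => a * t + b) '' θ.dom := by
          ext s
          constructor
          · intro hs
            refine ⟨(s - b) / a, hs, ?_⟩
            field_simp
            ring
          · rintro ⟨t, ht, rfl⟩
            change (a * t + b - b) / a ∈ θ.dom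
            rwa [hcancel]
        rw [himage]
        exact hdc.image _ (by fun_prop)
      · refine contDiffOn_const.mul (hgs.comp ?_ fun s hs => hs)
        fun_prop
      · intro s hs
        exact mul_ne_zero (div_ne_zero (pow_ne_zero _ hc0) ha0) (hg0 _ hs)
    refine ⟨Metric.ball q ε, θ', fun q => (a * q.1 + b, c * q.2.1 + e, A * q.2.2),
      Metric.mem_ball_self hε, ⟨hθ, hθ'c, ?_, fun r hr => (hball hr).1, ?_, ?_, ?_⟩, ?_⟩
    · exact ⟨⟨q, Metric.mem_ball_self hε⟩, (convex_ball q ε).isPreconnected⟩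
    · intro r hr
      refine ⟨?_, mul_pos h2 (hball hr).1.2⟩
      change (a * r.1 + b - b) / a ∈ θ.dom
      rw [hcancel]
      exact (hball hr).1.1
    · refine ⟨Metric.isOpen_ball, by fun_prop, fun r hr => ?_⟩
      refine det_fderiv_ne_zero_of_leftInverse
        (g := fun q => ((q.1 - b) / a, (q.2.1 - e) / c, q.2.2 / A)) (by fun_prop) (by fun_prop)
        (.of_forall fun q => ?_)
      have hA0 := h2.ne'
      refine Prod.ext ?_ (Prod.ext ?_ ?_)
      · exact hcancel q.1
      · change (c * q.2.1 + e - e) / c = q.2.1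
        field_simp
        ring
      · exact mul_div_cancel_left₀ _ hA0
    · refine mapsEquation_affine ha0 hc0 h2 h3 rfl (fun r hr => (hball hr).1.2) fun r hr => ?_
      change c ^ 2 / a * θ.g ((a * r.1 + b - b) / a) = _
      rw [hcancel]
    · intro r hr
      refine ⟨(hball hr).2, ?_⟩
      rw [hΦ _ (hball hr).2]
      simp only [ArbElem.lift, nCoord, affTransf, ha, hb, hc, he, hθ', hcancel, A]

/-! ### Differential equations for the elements of the group -/

/-- The unit vector of the space of `(t, x, u, g, n)` in the direction of `t`. -/
def Et : ExtSpace := (1, 0, 0, 0, 0)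

/-- The unit vector of the space of `(t, x, u, g, n)` in the direction of `x`. -/
def Ex : ExtSpace := (0, 1, 0, 0, 0)

/-- The unit vector of the space of `(t, x, u, g, n)` in the direction of `u`. -/
def Eu : ExtSpace := (0, 0, 1, 0, 0)

/-- The unit vector of the space of `(t, x, u, g, n)` in the direction of `g`. -/
def Eg : ExtSpace := (0, 0, 0, 1, 0)

/-- The unit vector of the space of `(t, x, u, g, n)` in the direction of `n`. -/
def En : ExtSpace := (0, 0, 0, 0, 1)

/-- The determining equations for the elements of the generalized equivalence group. -/
structure DeterminedAt (Φ : ExtSpace → ExtSpace) (p : ExtSpace) : Prop where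
  Tx : pd Ex (fun p => (Φ p).1) p = 0
  Tu : pd Eu (fun p => (Φ p).1) p = 0
  Tg : pd Eg (fun p => (Φ p).1) p = 0
  Ttt : pd Et (pd Et fun p => (Φ p).1) p = 0
  Xt : pd Et (fun p => (Φ p).2.1) p = 0
  Xu : pd Eu (fun p => (Φ p).2.1) p = 0
  Xg : pd Eg (fun p => (Φ p).2.1) p = 0
  Xxx : pd Ex (pd Ex fun p => (Φ p).2.1) p = 0
  U_eq : (Φ p).2.2.1 = p.2.2.1 * pd Eu (fun p => (Φ p).2.2.1) p
  T_eq : pd Eu (fun p => (Φ p).2.2.1) p ^ nCoord p * pd Et (fun p => (Φ p).1) p =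
    pd Ex (fun p => (Φ p).2.1) p
  G_eq : (Φ p).2.2.2.1 = pd Ex (fun p => (Φ p).2.1) p *
    pd Eu (fun p => (Φ p).2.2.1) p ^ nCoord p * p.2.2.2.1
  n_eq : nCoord (Φ p) = nCoord p

theorem pd_eq_of_line {E : Type*} [NormedAddCommGroup E] [NormedSpace ℝ E] {D : Set E}
    (hD : IsOpen D) {f : E → ℝ} (hf : ContDiffOn ℝ ∞ f D) {p v : E} (hp : p ∈ D) {c₁ c₀ : ℝ}
    (h : ∀ᶠ r : ℝ in 𝓝 0, f (p + r • v) = c₁ * r + c₀) : pd v f p = c₁ := by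
  have h1 : HasDerivAt (fun r : ℝ => c₁ * r + c₀) c₁ 0 := by
    simpa using ((hasDerivAt_id (0 : ℝ)).const_mul c₁).add_const c₀
  exact (hasDerivAt_pd hD hf hp v).unique (h1.congr_of_eventuallyEq h)

theorem pd_pd_eq_zero_of_line {E : Type*} [NormedAddCommGroup E] [NormedSpace ℝ E] {D : Set E}
    (hD : IsOpen D) {f : E → ℝ} (hf : ContDiffOn ℝ ∞ f D) {p v : E} (hp : p ∈ D) {c₁ c₀ : ℝ}
    (h : ∀ᶠ r : ℝ in 𝓝 0, f (p + r • v) = c₁ * r + c₀) : pd v (pd v f) p = 0 := by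
  refine pd_eq_of_line hD (contDiffOn_pd hD hf v) hp (c₀ := c₁) ?_
  filter_upwards [h.eventually_nhds, eventually_mem_line hD hp v] with r hr hrD
  rw [zero_mul, zero_add]
  refine pd_eq_of_line hD hf hrD (c₀ := c₁ * r + c₀) ?_
  have hc : Tendsto (fun s : ℝ => r + s) (𝓝 0) (𝓝 r) := by
    have : ContinuousAt (fun s : ℝ => r + s) 0 := by fun_prop
    simpa [ContinuousAt] using this
  filter_upwards [hc.eventually hr] with s hs
  rw [add_assoc, ← add_smul, hs]
  ring

variable {N : Set ℝ} {D : Set ExtSpace} {Φ : ExtSpace → ExtSpace}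

/-- The form of an element of the group along the graph of a coefficient `g` with arbitrary
logarithmic derivative `s` at a given point. -/
theorem InGenEquivGroup.exists_local (hN : N ⊆ allExponents) (h : InGenEquivGroup N D Φ)
    {t x u g n : ℝ} (hp : (t, x, u, g, n) ∈ D) (hn : n ≠ 1) (s : ℝ) :
    ∃ α β δ₁ δ₀ : ℝ, 0 < α * δ₁ ∧ ∀ᶠ r : ℝ × ℝ × ℝ in 𝓝 (t, x, u),
      Φ (r.1, r.2.1, r.2.2, g * Real.exp (s * (r.1 - t)), n) =
        affTransf α β δ₁ δ₀ (r.1, r.2.1, r.2.2, g * Real.exp (s * (r.1 - t)), n) := by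
  obtain ⟨hDN, -, -, hθ⟩ := h
  obtain ⟨hu, hg, hnN⟩ := hDN hp
  set θ : ArbElem := ⟨univ, fun r => g * Real.exp (s * (r - t)), n⟩ with hθdef
  have hθN : θ.InClass N := by
    refine ⟨isOpen_univ, isConnected_univ, ?_, fun r _ => mul_ne_zero hg (Real.exp_ne_zero _), hnN⟩
    have hg' : ContDiff ℝ ∞ fun r => g * Real.exp (s * (r - t)) := by fun_prop
    exact hg'.contDiffOn
  have hlift : θ.lift (t, x, u) = (t, x, u, g, n) := by simp [ArbElem.lift, hθdef]
  obtain ⟨Ω, θ', φ, hq, hadm, hind⟩ := hθ θ hθN (t, x, u) ⟨mem_univ _, hu⟩ (by rwa [hlift])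
  obtain ⟨-, α, β, δ₁, δ₀, hpos, hind'⟩ := hadm.exists_affTransf hN hn
  refine ⟨α, β, δ₁, δ₀, hpos, ?_⟩
  have hΩ : IsOpen Ω := hadm.2.2.2.2.2.1.1
  filter_upwards [hΩ.mem_nhds hq] with r hr
  exact (hind r hr).2.trans (hind' r hr).2.symm

/-- The slope along the graph of the coefficient is affine in the logarithmic derivative `s`, so two
values of `s` separate `f_t` from `f_g`. -/
theorem hasDerivAt_exp_curve (hD : IsOpen D) {f : ExtSpace → ℝ} (hf : ContDiffOn ℝ ∞ f D)
    {t x u g n : ℝ} (hp : (t, x, u, g, n) ∈ D) (s : ℝ) :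
    HasDerivAt (fun r : ℝ => f (t + r, x, u, g * Real.exp (s * (t + r - t)), n))
      (pd Et f (t, x, u, g, n) + g * s * pd Eg f (t, x, u, g, n)) 0 := by
  have hd := ((hf.contDiffAt (hD.mem_nhds hp)).differentiableAt (by simp)).hasFDerivAt
  have h1 : HasDerivAt (fun r : ℝ => ((t + r, x, u, g * Real.exp (s * (t + r - t)), n) : ExtSpace))
      (1, 0, 0, g * s, 0) 0 := by
    have e1 : HasDerivAt (fun r : ℝ => t + r) 1 0 := (hasDerivAt_id (0 : ℝ)).const_add t
    have e2 : HasDerivAt (fun r : ℝ => g * Real.exp (s * (t + r - t))) (g * s) 0 := by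
      simpa using ((((e1.sub_const t).const_mul s).exp).const_mul g)
    exact e1.prodMk ((hasDerivAt_const _ _).prodMk ((hasDerivAt_const _ _).prodMk
      (e2.prodMk (hasDerivAt_const _ _))))
  have hc : ((t + 0, x, u, g * Real.exp (s * (t + 0 - t)), n) : ExtSpace) = (t, x, u, g, n) := by
    simp
  rw [← hc] at hd
  have h2 := hd.comp_hasDerivAt (0 : ℝ) h1
  rw [hc] at h2
  have h3 : ((1, 0, 0, g * s, 0) : ExtSpace) = Et + (g * s) • Eg := by simp [Et, Eg]
  rw [h3, map_add, map_smul] at h2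
  exact h2

/-- For each `s` the induced transformation is affine, with parameters that may depend on `s`. At
the base point `X_x = δ₁` and `U_u = (δ₁/α)^(1/n)` are values of derivatives of `Φ` in which `s`
does not occur, so `α` does not depend on `s` either. Hence `T_t + g s T_g = α` and `X_t + g s X_g =
0` at `s = 0, 1` give `T_g = X_t = X_g = 0`. -/
theorem InGenEquivGroup.determinedAt_of_ne_one (hN : N ⊆ allExponents)
    (h : InGenEquivGroup N D Φ) {p : ExtSpace} (hp : p ∈ D) (hn : nCoord p ≠ 1) :
    DeterminedAt Φ p := by
  obtain ⟨t, x, u, g, n⟩ := p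
  have hD : IsOpen D := h.2.2.1.1
  have hs : ContDiffOn ℝ ∞ Φ D := h.2.2.1.2.1
  have hT : ContDiffOn ℝ ∞ (fun p => (Φ p).1) D := hs.fst
  have hX : ContDiffOn ℝ ∞ (fun p => (Φ p).2.1) D := hs.snd.fst
  have hU : ContDiffOn ℝ ∞ (fun p => (Φ p).2.2.1) D := hs.snd.snd.fst
  have hn0 : n ≠ 0 := hN (h.1 hp).2.2
  have hg : g ≠ 0 := (h.1 hp).2.1
  have key : ∀ s : ℝ, ∃ α β δ₁ δ₀ : ℝ, 0 < α * δ₁ ∧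
      (∀ᶠ r : ℝ in 𝓝 0, Φ (t + r, x, u, g * Real.exp (s * (t + r - t)), n) =
        affTransf α β δ₁ δ₀ (t + r, x, u, g * Real.exp (s * (t + r - t)), n)) ∧
      (∀ᶠ r : ℝ in 𝓝 0, Φ ((t, x, u, g, n) + r • Ex) =
        affTransf α β δ₁ δ₀ ((t, x, u, g, n) + r • Ex)) ∧
      (∀ᶠ r : ℝ in 𝓝 0, Φ ((t, x, u, g, n) + r • Eu) =
        affTransf α β δ₁ δ₀ ((t, x, u, g, n) + r • Eu)) := by
    intro s
    obtain ⟨α, β, δ₁, δ₀, hpos, hev⟩ := h.exists_local hN hp hn s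
    refine ⟨α, β, δ₁, δ₀, hpos, ?_, ?_, ?_⟩
    · have hc : Tendsto (fun r : ℝ => ((t + r, x, u) : ℝ × ℝ × ℝ)) (𝓝 0) (𝓝 (t, x, u)) := by
        have : ContinuousAt (fun r : ℝ => ((t + r, x, u) : ℝ × ℝ × ℝ)) 0 := by fun_prop
        simpa [ContinuousAt] using this
      exact hc.eventually hev
    · have hc : Tendsto (fun r : ℝ => ((t, x + r, u) : ℝ × ℝ × ℝ)) (𝓝 0) (𝓝 (t, x, u)) := by
        have : ContinuousAt (fun r : ℝ => ((t, x + r, u) : ℝ × ℝ × ℝ)) 0 := by fun_prop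
        simpa [ContinuousAt] using this
      filter_upwards [hc.eventually hev] with r hr
      simpa [Ex] using hr
    · have hc : Tendsto (fun r : ℝ => ((t, x, u + r) : ℝ × ℝ × ℝ)) (𝓝 0) (𝓝 (t, x, u)) := by
        have : ContinuousAt (fun r : ℝ => ((t, x, u + r) : ℝ × ℝ × ℝ)) 0 := by fun_prop
        simpa [ContinuousAt] using this
      filter_upwards [hc.eventually hev] with r hr
      simpa [Eu] using hr
  have key' : ∀ s : ℝ, ∃ α β δ₁ δ₀ : ℝ, 0 < α * δ₁ ∧
      pd Et (fun p => (Φ p).1) (t, x, u, g, n) +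
        g * s * pd Eg (fun p => (Φ p).1) (t, x, u, g, n) = α ∧
      pd Et (fun p => (Φ p).2.1) (t, x, u, g, n) +
        g * s * pd Eg (fun p => (Φ p).2.1) (t, x, u, g, n) = 0 ∧
      pd Ex (fun p => (Φ p).2.1) (t, x, u, g, n) = δ₁ ∧
      pd Eu (fun p => (Φ p).2.2.1) (t, x, u, g, n) = (δ₁ / α) ^ (1 / n) ∧
      Φ (t, x, u, g, n) = affTransf α β δ₁ δ₀ (t, x, u, g, n) := by
    intro s
    obtain ⟨α, β, δ₁, δ₀, hpos, ht, hx, hu⟩ := key s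
    refine ⟨α, β, δ₁, δ₀, hpos, ?_, ?_, ?_, ?_, by simpa using ht.self_of_nhds⟩
    · refine (hasDerivAt_exp_curve hD hT hp s).unique ?_
      have h1 : HasDerivAt (fun r : ℝ => α * (t + r) + β) α 0 := by
        simpa using (((hasDerivAt_id (0 : ℝ)).const_add t).const_mul α).add_const β
      refine h1.congr_of_eventuallyEq ?_
      filter_upwards [ht] with r hr
      rw [hr]
      rfl
    · refine (hasDerivAt_exp_curve hD hX hp s).unique ?_
      refine (hasDerivAt_const (0 : ℝ) (δ₁ * x + δ₀)).congr_of_eventuallyEq ?_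
      filter_upwards [ht] with r hr
      rw [hr]
      rfl
    · refine pd_eq_of_line hD hX hp (c₀ := δ₁ * x + δ₀) ?_
      filter_upwards [hx] with r hr
      rw [hr]
      simp [affTransf, Ex]
      ring
    · refine pd_eq_of_line hD hU hp (c₀ := (δ₁ / α) ^ (1 / n) * u) ?_
      filter_upwards [hu] with r hr
      rw [hr]
      simp [affTransf, Eu, nCoord]
      ring
  obtain ⟨α, β, δ₁, δ₀, hpos, ht, hx, hu⟩ := key 0
  obtain ⟨a, b, c, d, hpos', kT, kX, kXx, kUu, kΦ⟩ := key' 0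
  obtain ⟨a', b', c', d', hpos'', kT', kX', kXx', kUu', -⟩ := key' 1
  obtain ⟨-, -, hA⟩ := affine_rpow hpos' hn0
  obtain ⟨-, -, hA'⟩ := affine_rpow hpos'' hn0
  have hc0 : c ≠ 0 := right_ne_zero_of_mul hpos'.ne'
  have ha0 : a ≠ 0 := left_ne_zero_of_mul hpos'.ne'
  have ha0' : a' ≠ 0 := left_ne_zero_of_mul hpos''.ne'
  rw [← kUu] at hA
  rw [← kUu', hA, ← kXx', kXx] at hA'
  have haa : a' = a := by
    field_simp at hA'
    exact hA'
  subst haa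
  -- For `s = 0` the coefficient is constant, so the curve is a straight line in the direction of
  -- `t` and gives the second derivative too.
  have ht0 : ∀ᶠ r : ℝ in 𝓝 0, (Φ ((t, x, u, g, n) + r • Et)).1 = α * r + (α * t + β) := by
    filter_upwards [ht] with r hr
    simp only [zero_mul, Real.exp_zero, mul_one] at hr
    have e : ((t, x, u, g, n) : ExtSpace) + r • Et = (t + r, x, u, g, n) := by simp [Et]
    rw [e, hr]
    simp only [affTransf]
    ring
  have hx0 : ∀ᶠ r : ℝ in 𝓝 0, (Φ ((t, x, u, g, n) + r • Ex)).2.1 = δ₁ * r + (δ₁ * x + δ₀) := by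
    filter_upwards [hx] with r hr
    rw [hr]
    simp [affTransf, Ex]
    ring
  refine ⟨?_, ?_, ?_, ?_, ?_, ?_, ?_, ?_, ?_, ?_, ?_, ?_⟩
  · refine pd_eq_of_line hD hT hp (c₀ := α * t + β) ?_
    filter_upwards [hx] with r hr
    rw [hr]
    simp [affTransf, Ex]
  · refine pd_eq_of_line hD hT hp (c₀ := α * t + β) ?_
    filter_upwards [hu] with r hr
    rw [hr]
    simp [affTransf, Eu]
  · apply mul_left_cancel₀ hg
    linear_combination kT' - kT
  · exact pd_pd_eq_zero_of_line hD hT hp ht0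
  · linear_combination kX
  · refine pd_eq_of_line hD hX hp (c₀ := δ₁ * x + δ₀) ?_
    filter_upwards [hu] with r hr
    rw [hr]
    simp [affTransf, Eu]
  · apply mul_left_cancel₀ hg
    linear_combination kX' - kX
  · exact pd_pd_eq_zero_of_line hD hX hp hx0
  · rw [kUu, kΦ]
    exact mul_comm _ _
  · have e : pd Et (fun p => (Φ p).1) (t, x, u, g, n) = a' := by linear_combination kT
    rw [e, kXx]
    change pd Eu (fun p => (Φ p).2.2.1) (t, x, u, g, n) ^ n * a' = c
    rw [hA, div_mul_cancel₀ _ ha0]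
  · rw [kXx]
    change _ = c * pd Eu (fun p => (Φ p).2.2.1) (t, x, u, g, n) ^ n * g
    rw [hA, kΦ]
    simp only [affTransf]
    ring
  · rw [kΦ]
    rfl

/-- Points with `n ≠ 1` are dense in an open set: move slightly in the direction of `n`. -/
theorem eqOn_of_eqOn_ne_one (hD : IsOpen D) {f₁ f₂ : ExtSpace → ℝ} (h₁ : ContinuousOn f₁ D)
    (h₂ : ContinuousOn f₂ D) (h : ∀ p ∈ D, nCoord p ≠ 1 → f₁ p = f₂ p) {p : ExtSpace}
    (hp : p ∈ D) : f₁ p = f₂ p := by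
  by_cases hn : nCoord p = 1
  · have hc : Tendsto (fun r : ℝ => p + r • En) (𝓝[≠] 0) (𝓝 p) := by
      have : ContinuousAt (fun r : ℝ => p + r • En) 0 := by fun_prop
      have h3 : Tendsto (fun r : ℝ => p + r • En) (𝓝 0) (𝓝 p) := by
        simpa [ContinuousAt] using this
      exact h3.mono_left nhdsWithin_le_nhds
    have t1 := ((h₁.continuousAt (hD.mem_nhds hp)).tendsto).comp hc
    have t2 := ((h₂.continuousAt (hD.mem_nhds hp)).tendsto).comp hc
    refine tendsto_nhds_unique_of_eventuallyEq t1 t2 ?_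
    filter_upwards [hc.eventually (hD.mem_nhds hp), self_mem_nhdsWithin] with r hr hr0
    refine h _ hr ?_
    have : nCoord (p + r • En) = nCoord p + r := by simp [nCoord, En]
    rw [this, hn]
    simpa using hr0
  · exact h p hp hn

theorem InGenEquivGroup.determinedAt (hN : N ⊆ allExponents)
    (h : InGenEquivGroup N D Φ) {p : ExtSpace} (hp : p ∈ D) : DeterminedAt Φ p := by
  have hD : IsOpen D := h.2.2.1.1
  have hs : ContDiffOn ℝ ∞ Φ D := h.2.2.1.2.1
  have hT : ContDiffOn ℝ ∞ (fun p => (Φ p).1) D := hs.fst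
  have hX : ContDiffOn ℝ ∞ (fun p => (Φ p).2.1) D := hs.snd.fst
  have hU : ContDiffOn ℝ ∞ (fun p => (Φ p).2.2.1) D := hs.snd.snd.fst
  have hG : ContinuousOn (fun p => (Φ p).2.2.2.1) D := hs.snd.snd.snd.fst.continuousOn
  have hn : ContinuousOn nCoord D := contDiff_nCoord.continuous.continuousOn
  have hT1 := fun v => contDiffOn_pd hD hT v
  have hX1 := fun v => contDiffOn_pd hD hX v
  have hU1 := (contDiffOn_pd hD hU Eu).continuousOn
  have hu : Continuous fun p : ExtSpace => p.2.2.1 := by fun_prop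
  have hg : Continuous fun p : ExtSpace => p.2.2.2.1 := by fun_prop
  have key := fun p hp hn => h.determinedAt_of_ne_one hN (p := p) hp hn
  have hUeq : ∀ p ∈ D, (Φ p).2.2.1 = p.2.2.1 * pd Eu (fun p => (Φ p).2.2.1) p := fun p hp =>
    eqOn_of_eqOn_ne_one hD hU.continuousOn (hu.continuousOn.mul hU1)
      (fun q hq hq1 => (key q hq hq1).U_eq) hp
  -- The relation `U = u U_u` is extended to `n = 1` before the others: it makes `U_u` positive
  -- there, and so `U_u^n` is continuous.
  have hUpos : ∀ p ∈ D, 0 < pd Eu (fun p => (Φ p).2.2.1) p := fun p hp =>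
    pos_of_mul_pos_right (hUeq p hp ▸ (h.2.1 hp).1) (h.1 hp).1.le
  have hUn : ContinuousOn (fun p => pd Eu (fun p => (Φ p).2.2.1) p ^ nCoord p) D :=
    hU1.rpow hn fun p hp => .inl (hUpos p hp).ne'
  refine ⟨?_, ?_, ?_, ?_, ?_, ?_, ?_, ?_, hUeq p hp, ?_, ?_, ?_⟩
  · exact eqOn_of_eqOn_ne_one hD (hT1 Ex).continuousOn continuousOn_const
      (fun q hq hq1 => (key q hq hq1).Tx) hp
  · exact eqOn_of_eqOn_ne_one hD (hT1 Eu).continuousOn continuousOn_const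
      (fun q hq hq1 => (key q hq hq1).Tu) hp
  · exact eqOn_of_eqOn_ne_one hD (hT1 Eg).continuousOn continuousOn_const
      (fun q hq hq1 => (key q hq hq1).Tg) hp
  · exact eqOn_of_eqOn_ne_one hD (contDiffOn_pd hD (hT1 Et) Et).continuousOn continuousOn_const
      (fun q hq hq1 => (key q hq hq1).Ttt) hp
  · exact eqOn_of_eqOn_ne_one hD (hX1 Et).continuousOn continuousOn_const
      (fun q hq hq1 => (key q hq hq1).Xt) hp
  · exact eqOn_of_eqOn_ne_one hD (hX1 Eu).continuousOn continuousOn_const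
      (fun q hq hq1 => (key q hq hq1).Xu) hp
  · exact eqOn_of_eqOn_ne_one hD (hX1 Eg).continuousOn continuousOn_const
      (fun q hq hq1 => (key q hq hq1).Xg) hp
  · exact eqOn_of_eqOn_ne_one hD (contDiffOn_pd hD (hX1 Ex) Ex).continuousOn continuousOn_const
      (fun q hq hq1 => (key q hq hq1).Xxx) hp
  · exact eqOn_of_eqOn_ne_one hD (hUn.mul (hT1 Et).continuousOn) (hX1 Ex).continuousOn
      (fun q hq hq1 => (key q hq hq1).T_eq) hp
  · exact eqOn_of_eqOn_ne_one hD hG (((hX1 Ex).continuousOn.mul hUn).mul hg.continuousOn)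
      (fun q hq hq1 => (key q hq hq1).G_eq) hp
  · exact eqOn_of_eqOn_ne_one hD (contDiff_nCoord.continuous.comp_continuousOn hs.continuousOn) hn
      (fun q hq hq1 => (key q hq hq1).n_eq) hp

/-! ### Integration over the sections of constant exponent -/

/-- A section is not open in the extended space, so `f` is pulled back to the space of `(t, x, u,
g)`, where the section becomes an open preconnected set. No condition on the `n`-derivative is
needed. -/
theorem eq_of_pd_eq_zero_on_section (hD : IsOpen D) {f : ExtSpace → ℝ} (hf : ContDiffOn ℝ ∞ f D)
    {n : ℝ} (hn : IsPreconnected {p | p ∈ D ∧ nCoord p = n})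
    (ht : ∀ p ∈ D, nCoord p = n → pd Et f p = 0) (hx : ∀ p ∈ D, nCoord p = n → pd Ex f p = 0)
    (hu : ∀ p ∈ D, nCoord p = n → pd Eu f p = 0) (hg : ∀ p ∈ D, nCoord p = n → pd Eg f p = 0)
    {p q : ExtSpace} (hp : p ∈ D) (hpn : nCoord p = n) (hq : q ∈ D) (hqn : nCoord q = n) :
    f p = f q := by
  set ι : ℝ × ℝ × ℝ × ℝ → ExtSpace := fun y => (y.1, y.2.1, y.2.2.1, y.2.2.2, n) with hι
  set ρ : ExtSpace → ℝ × ℝ × ℝ × ℝ := fun p => (p.1, p.2.1, p.2.2.1, p.2.2.2.1) with hρ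
  have hιρ : ∀ p, nCoord p = n → ι (ρ p) = p := fun p hp => by
    change (p.1, p.2.1, p.2.2.1, p.2.2.2.1, n) = p
    rw [← hp]
    rfl
  have hιc : Continuous ι := by fun_prop
  have hpre : IsPreconnected (ι ⁻¹' D) := by
    have h1 : ι ⁻¹' D = ρ '' {p | p ∈ D ∧ nCoord p = n} := by
      ext y
      constructor
      · exact fun hy => ⟨ι y, ⟨hy, rfl⟩, rfl⟩
      · rintro ⟨r, ⟨hr, hrn⟩, rfl⟩
        rw [mem_preimage, hιρ r hrn]
        exact hr
    rw [h1]
    exact hn.image _ (Continuous.continuousOn (by fun_prop))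
  have hι1 : ∀ y, DifferentiableAt ℝ ι y := fun y => by fun_prop
  have hfd : ∀ r ∈ D, DifferentiableAt ℝ f r := fun r hr =>
    (hf.contDiffAt (hD.mem_nhds hr)).differentiableAt (by simp)
  have hιd : ∀ y v, fderiv ℝ ι y v = v.1 • Et + v.2.1 • Ex + v.2.2.1 • Eu + v.2.2.2 • Eg := by
    intro y v
    let s := ContinuousLinearMap.snd ℝ ℝ (ℝ × ℝ × ℝ)
    let s' := (ContinuousLinearMap.snd ℝ ℝ (ℝ × ℝ)).comp s
    let L := (ContinuousLinearMap.fst ℝ ℝ (ℝ × ℝ × ℝ)).smulRight Et +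
      ((ContinuousLinearMap.fst ℝ ℝ (ℝ × ℝ)).comp s).smulRight Ex +
      ((ContinuousLinearMap.fst ℝ ℝ ℝ).comp s').smulRight Eu +
      ((ContinuousLinearMap.snd ℝ ℝ ℝ).comp s').smulRight Eg
    have e : ι = fun y => L y + n • En := by
      funext y
      simp [hι, L, s, s', Et, Ex, Eu, Eg, En]
    have e' : HasFDerivAt ι L y := e ▸ L.hasFDerivAt.add_const (n • En)
    rw [e'.fderiv]
    rfl
  have hconst : f (ι (ρ p)) = f (ι (ρ q)) := by
    refine (hD.preimage hιc).is_const_of_fderiv_eq_zero (𝕜 := ℝ) (f := f ∘ ι) hpre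
      (fun y hy => ((hfd _ hy).comp y (hι1 y)).differentiableWithinAt) ?_
      (by rw [mem_preimage, hιρ p hpn]; exact hp) (by rw [mem_preimage, hιρ q hqn]; exact hq)
    intro y hy
    refine ContinuousLinearMap.ext fun v => ?_
    have e := hιd y v
    rw [fderiv_comp y (hfd _ hy) (hι1 y), ContinuousLinearMap.comp_apply, e, map_add, map_add,
      map_add, map_smul, map_smul, map_smul, map_smul]
    have h1 := ht _ hy rfl
    have h2 := hx _ hy rfl
    have h3 := hu _ hy rfl
    have h4 := hg _ hy rfl
    simp only [pd] at h1 h2 h3 h4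
    rw [h1, h2, h3, h4]
    simp
  rwa [hιρ p hpn, hιρ q hqn] at hconst

/-- A smooth function that is constant on the sections `n = const` is a smooth function of `n`. -/
theorem exists_contDiffOn_comp_nCoord (hD : IsOpen D) {f : ExtSpace → ℝ}
    (hf : ContDiffOn ℝ ∞ f D) (h : ∀ p ∈ D, ∀ q ∈ D, nCoord p = nCoord q → f p = f q) :
    ∃ F : ℝ → ℝ, ContDiffOn ℝ ∞ F (nCoord '' D) ∧ ∀ p ∈ D, f p = F (nCoord p) := by
  classical
  set F : ℝ → ℝ := fun n => if hn : ∃ p ∈ D, nCoord p = n then f hn.choose else 0 with hF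
  have hFe : ∀ p ∈ D, f p = F (nCoord p) := fun p hp => by
    have hn : ∃ q ∈ D, nCoord q = nCoord p := ⟨p, hp, rfl⟩
    simp only [hF, dif_pos hn]
    exact h p hp _ hn.choose_spec.1 hn.choose_spec.2.symm
  refine ⟨F, ?_, hFe⟩
  rintro _ ⟨p, hp, rfl⟩
  -- Near `nCoord p` the function `F` is the restriction of `f` to the line through `p` in the
  -- direction of `n`, hence smooth.
  have hc : ContDiff ℝ ∞ fun m : ℝ => p + (m - nCoord p) • En := by fun_prop
  have hcp : p + (nCoord p - nCoord p) • En = p := by simp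
  have hcn : ∀ m, nCoord (p + (m - nCoord p) • En) = m := fun m => by simp [nCoord, En]
  have h1 : ContDiffAt ℝ ∞ (fun m : ℝ => f (p + (m - nCoord p) • En)) (nCoord p) := by
    refine ContDiffAt.comp (nCoord p) ?_ hc.contDiffAt
    rw [hcp]
    exact hf.contDiffAt (hD.mem_nhds hp)
  refine (h1.congr_of_eventuallyEq ?_).contDiffWithinAt
  have h2 : ∀ᶠ m in 𝓝 (nCoord p), p + (m - nCoord p) • En ∈ D := by
    refine hc.continuous.continuousAt.eventually_mem ?_
    rw [hcp]
    exact hD.mem_nhds hp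
  filter_upwards [h2] with m hm
  rw [hFe _ hm, hcn]

/-- The parameters are `α = T_t`, `δ₁ = X_x`, `β = T - α t` and `δ₀ = X - δ₁ x`. By `DeterminedAt`
their derivatives along a section vanish, so they are functions of `n`; the components `U` and `g`
are then fixed by `U_eq`, `T_eq` and `G_eq`. -/
theorem InGenEquivGroup.exists_affTransf (hN : N ⊆ allExponents)
    (hsec : ∀ n : ℝ, IsPreconnected {p | p ∈ D ∧ nCoord p = n}) (h : InGenEquivGroup N D Φ) :
    ∃ α β δ₁ δ₀ : ℝ → ℝ,
      (ContDiffOn ℝ ∞ α (nCoord '' D) ∧ ContDiffOn ℝ ∞ β (nCoord '' D) ∧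
        ContDiffOn ℝ ∞ δ₁ (nCoord '' D) ∧ ContDiffOn ℝ ∞ δ₀ (nCoord '' D)) ∧
      (∀ n ∈ nCoord '' D, 0 < α n * δ₁ n) ∧
      ∀ p ∈ D, Φ p = affTransf (α (nCoord p)) (β (nCoord p)) (δ₁ (nCoord p))
        (δ₀ (nCoord p)) p := by
  have hD : IsOpen D := h.2.2.1.1
  have hs : ContDiffOn ℝ ∞ Φ D := h.2.2.1.2.1
  have hT : ContDiffOn ℝ ∞ (fun p => (Φ p).1) D := hs.fst
  have hX : ContDiffOn ℝ ∞ (fun p => (Φ p).2.1) D := hs.snd.fst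
  have hdet := fun p hp => h.determinedAt hN (p := p) hp
  have hTd : ∀ p ∈ D, DifferentiableAt ℝ (fun p => (Φ p).1) p := fun p hp =>
    (hT.contDiffAt (hD.mem_nhds hp)).differentiableAt (by simp)
  have hXd : ∀ p ∈ D, DifferentiableAt ℝ (fun p => (Φ p).2.1) p := fun p hp =>
    (hX.contDiffAt (hD.mem_nhds hp)).differentiableAt (by simp)
  have hm : MapsTo nCoord D (nCoord '' D) := mapsTo_image _ _
  obtain ⟨α, hα, hαe⟩ := exists_contDiffOn_comp_nCoord hD (contDiffOn_pd hD hT Et)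
    fun p hp q hq hpq => eq_of_pd_eq_zero_on_section hD (contDiffOn_pd hD hT Et)
      (hsec (nCoord q)) (fun r hr _ => (hdet r hr).Ttt)
      (fun r hr _ => by rw [pd_comm hD hT hr, pd_eq_zero hD hr fun r hr => (hdet r hr).Tx])
      (fun r hr _ => by rw [pd_comm hD hT hr, pd_eq_zero hD hr fun r hr => (hdet r hr).Tu])
      (fun r hr _ => by rw [pd_comm hD hT hr, pd_eq_zero hD hr fun r hr => (hdet r hr).Tg])
      hp hpq hq rfl
  obtain ⟨δ₁, hδ₁, hδ₁e⟩ := exists_contDiffOn_comp_nCoord hD (contDiffOn_pd hD hX Ex)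
    fun p hp q hq hpq => eq_of_pd_eq_zero_on_section hD (contDiffOn_pd hD hX Ex)
      (hsec (nCoord q))
      (fun r hr _ => by rw [pd_comm hD hX hr, pd_eq_zero hD hr fun r hr => (hdet r hr).Xt])
      (fun r hr _ => (hdet r hr).Xxx)
      (fun r hr _ => by rw [pd_comm hD hX hr, pd_eq_zero hD hr fun r hr => (hdet r hr).Xu])
      (fun r hr _ => by rw [pd_comm hD hX hr, pd_eq_zero hD hr fun r hr => (hdet r hr).Xg])
      hp hpq hq rfl
  have ht : ContDiff ℝ ∞ fun p : ExtSpace => p.1 := contDiff_fst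
  have hx : ContDiff ℝ ∞ fun p : ExtSpace => p.2.1 := contDiff_snd.fst
  obtain ⟨β, hβ, hβe⟩ := exists_contDiffOn_comp_nCoord hD
    (f := fun p => (Φ p).1 - α (nCoord p) * p.1)
    (hT.sub ((hα.comp contDiff_nCoord.contDiffOn hm).mul ht.contDiffOn)) fun p hp q hq hpq => by
      -- On one section `α` is a number, so `α t` may be replaced by a linear functional whose
      -- derivatives are immediate.
      let B : ExtSpace →L[ℝ] ℝ := α (nCoord q) • ContinuousLinearMap.fst ℝ ℝ (ℝ × ℝ × ℝ × ℝ)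
      rw [hpq]
      refine eq_of_pd_eq_zero_on_section (f := fun p => (Φ p).1 - B p) hD
        (hT.sub B.contDiff.contDiffOn) (hsec (nCoord q)) (fun r hr hrq => ?_) (fun r hr _ => ?_)
        (fun r hr _ => ?_) (fun r hr _ => ?_) hp hpq hq rfl
      · rw [pd_sub_clm (hTd r hr), hαe r hr, hrq]
        simp [B, Et]
      · rw [pd_sub_clm (hTd r hr), (hdet r hr).Tx]
        simp [B, Ex]
      · rw [pd_sub_clm (hTd r hr), (hdet r hr).Tu]
        simp [B, Eu]
      · rw [pd_sub_clm (hTd r hr), (hdet r hr).Tg]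
        simp [B, Eg]
  obtain ⟨δ₀, hδ₀, hδ₀e⟩ := exists_contDiffOn_comp_nCoord hD
    (f := fun p => (Φ p).2.1 - δ₁ (nCoord p) * p.2.1)
    (hX.sub ((hδ₁.comp contDiff_nCoord.contDiffOn hm).mul hx.contDiffOn)) fun p hp q hq hpq => by
      let B : ExtSpace →L[ℝ] ℝ := δ₁ (nCoord q) • (ContinuousLinearMap.fst ℝ ℝ (ℝ × ℝ × ℝ)).comp
        (ContinuousLinearMap.snd ℝ ℝ (ℝ × ℝ × ℝ × ℝ))
      rw [hpq]
      refine eq_of_pd_eq_zero_on_section (f := fun p => (Φ p).2.1 - B p) hD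
        (hX.sub B.contDiff.contDiffOn) (hsec (nCoord q)) (fun r hr _ => ?_) (fun r hr hrq => ?_)
        (fun r hr _ => ?_) (fun r hr _ => ?_) hp hpq hq rfl
      · rw [pd_sub_clm (hXd r hr), (hdet r hr).Xt]
        simp [B, Et]
      · rw [pd_sub_clm (hXd r hr), hδ₁e r hr, hrq]
        simp [B, Ex]
      · rw [pd_sub_clm (hXd r hr), (hdet r hr).Xu]
        simp [B, Eu]
      · rw [pd_sub_clm (hXd r hr), (hdet r hr).Xg]
        simp [B, Eg]
  have hUpos : ∀ p ∈ D, 0 < pd Eu (fun p => (Φ p).2.2.1) p := fun p hp =>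
    pos_of_mul_pos_right ((hdet p hp).U_eq ▸ (h.2.1 hp).1) (h.1 hp).1.le
  have hne : ∀ p ∈ D, α (nCoord p) ≠ 0 ∧ δ₁ (nCoord p) ≠ 0 := by
    intro p hp
    have h1 : δ₁ (nCoord p) ≠ 0 := by
      have h2 := (hdet p hp).G_eq ▸ (h.2.1 hp).2.1
      rw [← hδ₁e p hp]
      exact left_ne_zero_of_mul (left_ne_zero_of_mul h2)
    have h3 := (hdet p hp).T_eq
    rw [hαe p hp, hδ₁e p hp] at h3
    exact ⟨right_ne_zero_of_mul (h3.trans_ne h1), h1⟩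
  refine ⟨α, β, δ₁, δ₀, ⟨hα, hβ, hδ₁, hδ₀⟩, ?_, ?_⟩
  · rintro _ ⟨p, hp, rfl⟩
    have h1 := (hdet p hp).T_eq
    rw [hαe p hp, hδ₁e p hp] at h1
    rw [← h1]
    -- By `T_eq` the product `α δ₁` equals `U_u^n α²`.
    have h2 := Real.rpow_pos_of_pos (hUpos p hp) (nCoord p)
    have h3 : 0 < α (nCoord p) ^ 2 := sq_pos_of_ne_zero (hne p hp).1
    exact (mul_pos h2 h3).trans_eq (by ring)
  · intro p hp
    obtain ⟨hα0, hδ0⟩ := hne p hp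
    have h1 := (hdet p hp).T_eq
    rw [hαe p hp, hδ₁e p hp] at h1
    have hU := hUpos p hp
    have h2 : pd Eu (fun p => (Φ p).2.2.1) p ^ nCoord p = δ₁ (nCoord p) / α (nCoord p) := by
      rw [← h1, mul_div_cancel_right₀ _ hα0]
    have hn0 : nCoord p ≠ 0 := hN (h.1 hp).2.2
    refine Prod.ext ?_ (Prod.ext ?_ (Prod.ext ?_ (Prod.ext ?_ (hdet p hp).n_eq)))
    · have := hβe p hp
      simp only [affTransf]
      linarith
    · have := hδ₀e p hp
      simp only [affTransf]
      linarith
    · simp only [affTransf]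
      rw [← h2, ← Real.rpow_mul hU.le, mul_one_div_cancel hn0, Real.rpow_one, (hdet p hp).U_eq,
        mul_comm]
    · simp only [affTransf]
      rw [(hdet p hp).G_eq, h2, hδ₁e p hp]
      ring

/-! ### Comparison of the two groups -/

theorem exponentsNeOne_subset : exponentsNeOne ⊆ allExponents := fun _ h => h.1

theorem isOpen_ext (hN : IsOpen N) : IsOpen (ext N) := by
  refine IsOpen.inter (isOpen_lt continuous_const
    (continuous_snd.snd.fst : Continuous fun p : ExtSpace => p.2.2.1)) (IsOpen.inter ?_ ?_)
  · exact isOpen_ne_fun (f := fun p : ExtSpace => p.2.2.2.1) (by fun_prop) continuous_const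
  · exact hN.preimage contDiff_nCoord.continuous

theorem isOpen_allExponents : IsOpen allExponents := isOpen_ne

theorem isOpen_exponentsNeOne : IsOpen exponentsNeOne := isOpen_ne.inter isOpen_ne

theorem inGenEquivGroup_ext_affTransf (hN : N ⊆ allExponents) (hN' : IsOpen N) {α β δ₁ δ₀ : ℝ}
    (h : 0 < α * δ₁) : InGenEquivGroup N (ext N) (affTransf α β δ₁ δ₀) :=
  inGenEquivGroup_affTransf hN (isOpen_ext hN') subset_rfl (α := fun _ => α) (β := fun _ => β)
    (δ₁ := fun _ => δ₁) (δ₀ := fun _ => δ₀) contDiffOn_const contDiffOn_const contDiffOn_const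
    contDiffOn_const (fun _ _ => h) fun _ _ => rfl

/-- Over a domain avoiding `n = 1` the same equations have to be tested for both classes. The
classes differ only in the targets they allow, and this is immaterial because the exponent is
preserved. -/
theorem inGenEquivGroup_exponentsNeOne_iff (hD : D ⊆ ext exponentsNeOne) :
    InGenEquivGroup exponentsNeOne D Φ ↔ InGenEquivGroup allExponents D Φ := by
  have hsub : ext exponentsNeOne ⊆ ext allExponents := fun p hp => ⟨hp.1, hp.2.1, hp.2.2.1⟩
  have hmono : ∀ {θ : ArbElem}, θ.InClass exponentsNeOne → θ.InClass allExponents :=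
    fun hθ => ⟨hθ.1, hθ.2.1, hθ.2.2.1, hθ.2.2.2.1, hθ.2.2.2.2.1⟩
  constructor
  · rintro ⟨-, hm, hp, h⟩
    refine ⟨hD.trans hsub, fun p hp => hsub (hm hp), hp, fun θ hθ q hq hqD => ?_⟩
    obtain ⟨Ω, θ', φ, hqΩ, ⟨h1, h2, h3⟩, h4⟩ :=
      h θ ⟨hθ.1, hθ.2.1, hθ.2.2.1, hθ.2.2.2.1, (hD hqD).2.2⟩ q hq hqD
    exact ⟨Ω, θ', φ, hqΩ, ⟨hmono h1, hmono h2, h3⟩, h4⟩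
  · intro hall
    refine ⟨hD, fun p hp => ?_, hall.2.2.1, fun θ hθ q hq hqD => ?_⟩
    · obtain ⟨h1, h2, -⟩ := hall.2.1 hp
      refine ⟨h1, h2, ?_⟩
      rw [(hall.determinedAt subset_rfl hp).n_eq]
      exact (hD hp).2.2
    · obtain ⟨Ω, θ', φ, hqΩ, hadm, h4⟩ := hall.2.2.2 θ (hmono hθ) q hq hqD
      obtain ⟨hn, -⟩ := hadm.exists_affTransf subset_rfl hθ.2.2.2.2.2
      obtain ⟨h1, h2, h3⟩ := hadm
      exact ⟨Ω, θ', φ, hqΩ, ⟨hθ, ⟨h2.1, h2.2.1, h2.2.2.1, h2.2.2.2.1, hn ▸ hθ.2.2.2.2⟩, h3⟩, h4⟩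

end GenBurgers

theorem mainTheorem7 :
    -- the subclass `n ≠ 1` is normalized in the generalized sense
    GenBurgers.NormalizedGen GenBurgers.exponentsNeOne ∧
    -- its equivalence groupoid is generated by the affine transformations with constant parameters
    (∀ (θ θ' : GenBurgers.ArbElem) (Ω : Set (ℝ × ℝ × ℝ)) (φ : ℝ × ℝ × ℝ → ℝ × ℝ × ℝ),
      GenBurgers.Admissible GenBurgers.exponentsNeOne θ θ' Ω φ →
      ∃ α β δ₁ δ₀ : ℝ, 0 < α * δ₁ ∧
        GenBurgers.Induces (GenBurgers.ext GenBurgers.exponentsNeOne)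
          (GenBurgers.affTransf α β δ₁ δ₀) θ θ' Ω φ) ∧
    -- the generalized equivalence groups of the subclass and of the entire class
    (∀ N : Set ℝ, N = GenBurgers.exponentsNeOne ∨ N = GenBurgers.allExponents →
      (∀ α β δ₁ δ₀ : ℝ, 0 < α * δ₁ →
        GenBurgers.InGenEquivGroup N (GenBurgers.ext N) (GenBurgers.affTransf α β δ₁ δ₀)) ∧
      ∀ (D : Set GenBurgers.ExtSpace) (Φ : GenBurgers.ExtSpace → GenBurgers.ExtSpace),
        IsOpen D → D ⊆ GenBurgers.ext N →
        (∀ n : ℝ, IsPreconnected {p | p ∈ D ∧ GenBurgers.nCoord p = n}) →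
        (GenBurgers.InGenEquivGroup N D Φ ↔
          ∃ α β δ₁ δ₀ : ℝ → ℝ,
            (ContDiffOn ℝ ∞ α (GenBurgers.nCoord '' D) ∧
              ContDiffOn ℝ ∞ β (GenBurgers.nCoord '' D) ∧
              ContDiffOn ℝ ∞ δ₁ (GenBurgers.nCoord '' D) ∧
              ContDiffOn ℝ ∞ δ₀ (GenBurgers.nCoord '' D)) ∧
            (∀ n ∈ GenBurgers.nCoord '' D, 0 < α n * δ₁ n) ∧
            ∀ p ∈ D, Φ p = GenBurgers.affTransf (α (GenBurgers.nCoord p))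
              (β (GenBurgers.nCoord p)) (δ₁ (GenBurgers.nCoord p)) (δ₀ (GenBurgers.nCoord p)) p)) ∧
    -- the two generalized equivalence groups coincide
    (∀ (D : Set GenBurgers.ExtSpace) (Φ : GenBurgers.ExtSpace → GenBurgers.ExtSpace),
      D ⊆ GenBurgers.ext GenBurgers.exponentsNeOne →
      (GenBurgers.InGenEquivGroup GenBurgers.exponentsNeOne D Φ ↔
        GenBurgers.InGenEquivGroup GenBurgers.allExponents D Φ)) := by

  have haff := fun (θ θ' : GenBurgers.ArbElem) (Ω : Set (ℝ × ℝ × ℝ))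
    (φ : ℝ × ℝ × ℝ → ℝ × ℝ × ℝ) (h : GenBurgers.Admissible GenBurgers.exponentsNeOne θ θ' Ω φ) =>
    (h.exists_affTransf GenBurgers.exponentsNeOne_subset h.1.2.2.2.2.2).2
  refine ⟨fun θ θ' Ω φ h => ?_, haff, ?_, fun D Φ hD =>
    GenBurgers.inGenEquivGroup_exponentsNeOne_iff hD⟩
  · obtain ⟨α, β, δ₁, δ₀, hpos, hind⟩ := haff θ θ' Ω φ h
    exact ⟨_, _, GenBurgers.inGenEquivGroup_ext_affTransf GenBurgers.exponentsNeOne_subset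
      GenBurgers.isOpen_exponentsNeOne hpos, hind⟩
  · intro N hN
    have hsub : N ⊆ GenBurgers.allExponents := by
      rcases hN with rfl | rfl
      · exact GenBurgers.exponentsNeOne_subset
      · exact subset_rfl
    have hopen : IsOpen N := by
      rcases hN with rfl | rfl
      · exact GenBurgers.isOpen_exponentsNeOne
      · exact GenBurgers.isOpen_allExponents
    refine ⟨fun α β δ₁ δ₀ h => GenBurgers.inGenEquivGroup_ext_affTransf hsub hopen h,
      fun D Φ hD hDN hsec => ⟨fun h => h.exists_affTransf hsub hsec, ?_⟩⟩
    rintro ⟨α, β, δ₁, δ₀, ⟨hα, hβ, hδ₁, hδ₀⟩, hpos, hΦ⟩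
    exact GenBurgers.inGenEquivGroup_affTransf hsub hD hDN hα hβ hδ₁ hδ₀ hpos hΦ
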